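/- **Setting.** Let $d,k\ge 1$, let $\Omega\subset\mathbb R^d$ be open, connected, nonempty and bounded, and let $p\in(1,\infty)$. Let $\Omega_1,\dots,\Omega_s\subseteq\Omega$ be open with $\bigcup_\ell\Omega_\ell=\Omega$, and let $\chi_1,\dots,\chi_s\in C^\infty(\Omega)$ satisfy $\chi_\ell>0$ on $\Omega_\ell$, $\chi_\ell=0$ on $\Omega\setminus\Omega_\ell$ and $\sum_\ell\chi_\ell=1$ on $\Omega$. Let $L^p(\Omega_\ell,\chi_\ell)$ be the space of measurable functions $v$ on $\Omega_\ell$ with $\int_{\Omega_\ell}\chi_\ell|v|^p\,dx<\infty$. Let $H$ be a real Hilbert space and $\delta:H\to\mathcal D'(\Omega)^k$ a linear map. Define $$V=\Bigl\{u\in H:\ \exists\, v=:\delta_pu\in L^p(\Omega)^k,\ (\delta u)_j(\phi)=\int_\Omega v_j\phi\,dx\ \ \forall \phi\in C_0^\infty(\Omega),\ j=1,\dots,k\Bigr\},$$ $$V_\ell=\Bigl\{u\in H:\ \exists\, v=:\delta_{p,\ell}u\in L^p(\Omega_\ell,\chi_\ell)^k,\ (\delta u)_j(\chi_\ell\phi)=\int_{\Omega_\ell}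 v_j\chi_\ell\phi\,dx\ \ \forall \phi\in C_0^\infty(\Omega),\ j=1,\dots,k\Bigr\}.$$ **Assumptions.** 1. If $u_n\to u$ in $H$, then $(\delta u_n)_j(\phi)\to(\delta u)_j(\phi)$ for all $j$ and all $\phi\in C_0^\infty(\Omega)$. 2. $V$ is dense in $H$. 3. $\alpha:\Omega\times\mathbb R^k\to\mathbb R^k$ is such that $z\mapsto\alpha(x,z)$ is continuous for a.e. $x$ and $x\mapsto\alpha(x,z)$ is measurable for every $z$; there are $c_1,c_3>0$, a nonnegative $c_2\in L^{p/(p-1)}(\Omega)$ and $c_4\in L^1(\Omega)$ such that, for a.e. $x\in\Omega$ and all $z,\tilde z\in\mathbb R^k$, $$|\alpha(x,z)|\le c_1|z|^{p-1}+c_2(x),\qquad (\alpha(x,z)-\alpha(x,\tilde z))\cdot(z-\tilde z)\ge 0,\qquad \alpha(x,z)\cdot z\ge c_3|z|^p-c_4(x).$$ Define $F$ on $V$ and $F_\ell$ on $V_\ell$ by $\langle Fu,v\rangle=\int_\Omega\alpha(x,\delta_pu)\cdot\delta_pv\,dx$ for $u,v\in V$ and $\langle F_\ell u,v\rangle=\int_{\Omega_\ell}\chi_\ell\,\alpha(x,\delta_{p,\ell}u)\cdot\delta_{p,\ell}v\,dx$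 for $u,v\in V_\ell$. With the Riesz isomorphism $\gamma:H\to H^*$, the Friedrich extensions are $D(f)=\{u\in V: Fu\in H^*\}$, $fu=-\gamma^{-1}Fu$, and $D(f_\ell)=\{u\in V_\ell: F_\ell u\in H^*\}$, $f_\ell u=-\gamma^{-1}F_\ell u$, where membership in $H^*$ means that the functional on $V$ (respectively $V_\ell$) is the restriction of a bounded linear functional on $H$. 4. For every $h>0$, $V\subseteq R\bigl(I-hf|_{\bigcap_\ell D(f_\ell)}\bigr)$, i.e. for every $v\in V$ there is $u\in\bigcap_\ell D(f_\ell)$ with $u-hfu=v$. 5. $D(f)$ is dense in $H$. **Theorem.** Under Assumptions 1–5, the resolvents $(I-hf)^{-1}$ and $(I-hf_\ell)^{-1}$, $\ell=1,\dots,s$, are well defined on all of $H$ for every $h>0$; the limit $e^{tf}\eta=\lim_{n\to\infty}(I-\tfrac tn f)^{-n}\eta$ exists in $H$ for all $t>0$ and $\eta\in H$; and the sum splitting $$S_h=\frac1s\sum_{\ell=1}^s(I-hsf_\ell)^{-1}:H\to H$$ converges to the mild solution $t\mapsto e^{tf}\eta$ of $\dot u=fu$, $u(0)=\eta$, uniformly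 on bounded time intervals: $$\lim_{n\to\infty}\ \sup_{t\in(0,T)}\bigl\|S_{t/n}^n\eta-e^{tf}\eta\bigr\|_H=0\qquad\text{for every }\eta\in H\text{ and }T<\infty .$$ -/

import Mathlib

open MeasureTheory Filter Topology Set TopologicalSpace
open scoped Distributions ContDiff InnerProductSpace

noncomputable section

namespace DomainSplitting

/-- A decomposition of `Ω` into open subsets `Ω_ℓ` covering `Ω`, together with a smooth partition
of unity `χ_ℓ` such that `χ_ℓ > 0` on `Ω_ℓ` and `χ_ℓ = 0` on `Ω \ Ω_ℓ`. The values of `χ_ℓ` outside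
`Ω` are irrelevant. -/
structure DomainDecomposition {d : ℕ} (Ω : Opens (EuclideanSpace ℝ (Fin d))) (s : ℕ) where
  /-- the subdomains `Ω_ℓ` -/
  dom : Fin s → Set (EuclideanSpace ℝ (Fin d))
  /-- the weights `χ_ℓ` -/
  χ : Fin s → EuclideanSpace ℝ (Fin d) → ℝ
  isOpen_dom : ∀ ℓ, IsOpen (dom ℓ)
  iUnion_dom : ⋃ ℓ, dom ℓ = (Ω : Set (EuclideanSpace ℝ (Fin d)))
  smooth : ∀ ℓ, ContDiffOn ℝ ∞ (χ ℓ) Ω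
  pos : ∀ ℓ, ∀ x ∈ dom ℓ, 0 < χ ℓ x
  zero : ∀ ℓ, ∀ x ∈ (Ω : Set (EuclideanSpace ℝ (Fin d))) \ dom ℓ, χ ℓ x = 0
  sum_eq_one : ∀ x ∈ Ω, ∑ ℓ, χ ℓ x = 1

/-- The product `χ φ` of a function that is smooth on `Ω` and a test function on `Ω`. -/
def mulTest {d : ℕ} {Ω : Opens (EuclideanSpace ℝ (Fin d))} (χ : EuclideanSpace ℝ (Fin d) → ℝ)
    (hχ : ContDiffOn ℝ ∞ χ Ω) (φ : 𝓓(Ω, ℝ)) : 𝓓(Ω, ℝ) where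
  toFun x := χ x * φ x
  contDiff' := by
    rw [contDiff_iff_contDiffAt]
    intro x
    by_cases hx : x ∈ tsupport φ
    · exact (hχ.contDiffAt (Ω.isOpen.mem_nhds (φ.tsupport_subset hx))).mul φ.contDiff.contDiffAt
    · have h0 : (fun x => χ x * φ x) =ᶠ[𝓝 x] fun _ => 0 := by
        filter_upwards [notMem_tsupport_iff_eventuallyEq.mp hx] with y hy
        simp [hy]
      exact contDiffAt_const.congr_of_eventuallyEq h0
  hasCompactSupport' := φ.hasCompactSupport.mul_left
  tsupport_subset' := (tsupport_mul_subset_right (f := χ) (g := φ)).trans φ.tsupport_subset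

/-- The structural conditions on the map `α : Ω × ℝᵏ → ℝᵏ`: the Carathéodory condition, growth,
monotonicity and coercivity. -/
structure IsEnergyMap {d k : ℕ} (Ω : Opens (EuclideanSpace ℝ (Fin d))) (p : ℝ)
    (α : EuclideanSpace ℝ (Fin d) → EuclideanSpace ℝ (Fin k) → EuclideanSpace ℝ (Fin k)) :
    Prop where
  continuous : ∀ᵐ x ∂(volume.restrict Ω), Continuous (α x)
  measurable : ∀ z, AEMeasurable (fun x => α x z) (volume.restrict Ω)
  growth : ∃ c₁ : ℝ, ∃ c₂ : EuclideanSpace ℝ (Fin d) → ℝ, 0 < c₁ ∧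
    MemLp c₂ (ENNReal.ofReal (p / (p - 1))) (volume.restrict Ω) ∧
    (∀ᵐ x ∂(volume.restrict Ω), 0 ≤ c₂ x) ∧
    ∀ᵐ x ∂(volume.restrict Ω), ∀ z, ‖α x z‖ ≤ c₁ * ‖z‖ ^ (p - 1) + c₂ x
  monotone : ∀ᵐ x ∂(volume.restrict Ω), ∀ z z', 0 ≤ ⟪α x z - α x z', z - z'⟫_ℝ
  coercive : ∃ c₃ : ℝ, ∃ c₄ : EuclideanSpace ℝ (Fin d) → ℝ, 0 < c₃ ∧ IntegrableOn c₄ Ω ∧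
    ∀ᵐ x ∂(volume.restrict Ω), ∀ z, c₃ * ‖z‖ ^ p - c₄ x ≤ ⟪α x z, z⟫_ℝ

section Energy

/-! The full and the decomposed objects are instances of one construction, for a measure `μ` and a
family `τ u = (τ u)_j`, `j = 1, …, k`, of functionals on the test functions: `μ` is the Lebesgue
measure on `Ω` and `τ u = δ u` for the full objects, `μ = χ_ℓ dx` on `Ω_ℓ` and `τ u = χ_ℓ δ u` for
the decomposed ones. -/

variable {d k : ℕ} {Ω : Opens (EuclideanSpace ℝ (Fin d))} {H : Type*}
  [NormedAddCommGroup H] [InnerProductSpace ℝ H]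

/-- `v ∈ L^p(μ)^k` represents `τ u`, i.e. `(τ u)_j (φ) = ∫ v_j φ dμ` for all `φ ∈ C₀^∞(Ω)`. -/
def Represents (p : ℝ) (μ : Measure (EuclideanSpace ℝ (Fin d)))
    (τ : H → Fin k → 𝓓(Ω, ℝ) → ℝ) (u : H)
    (v : EuclideanSpace ℝ (Fin d) → EuclideanSpace ℝ (Fin k)) : Prop :=
  MemLp v (ENNReal.ofReal p) μ ∧ ∀ (j : Fin k) (φ : 𝓓(Ω, ℝ)), τ u j φ = ∫ x, v x j * φ x ∂μ

/-- The energetic space: all `u ∈ H` for which `τ u` is represented by an `L^p(μ)^k` function. -/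
def energySpace (p : ℝ) (μ : Measure (EuclideanSpace ℝ (Fin d)))
    (τ : H → Fin k → 𝓓(Ω, ℝ) → ℝ) : Set H :=
  {u | ∃ v, Represents p μ τ u v}

open Classical in
/-- The `L^p(μ)^k` function representing `τ u`, for `u` in the energetic space. -/
def energyRep (p : ℝ) (μ : Measure (EuclideanSpace ℝ (Fin d)))
    (τ : H → Fin k → 𝓓(Ω, ℝ) → ℝ) (u : H) :
    EuclideanSpace ℝ (Fin d) → EuclideanSpace ℝ (Fin k) :=
  if h : ∃ v, Represents p μ τ u v then h.choose else 0

/-- The energetic operator, `⟨F u, v⟩ = ∫ α(x, τ_p u) · τ_p v dμ`, where `τ_p u` is the `L^p(μ)^k`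
function representing `τ u`. -/
def energyForm (p : ℝ)
    (α : EuclideanSpace ℝ (Fin d) → EuclideanSpace ℝ (Fin k) → EuclideanSpace ℝ (Fin k))
    (μ : Measure (EuclideanSpace ℝ (Fin d))) (τ : H → Fin k → 𝓓(Ω, ℝ) → ℝ) (u v : H) : ℝ :=
  ∫ x, ⟪α x (energyRep p μ τ u x), energyRep p μ τ v x⟫_ℝ ∂μ

end Energy

section Friedrich

variable {H : Type*} [NormedAddCommGroup H] [InnerProductSpace ℝ H]

/-- The domain `{u ∈ V : F u ∈ H*}` of the Friedrich extension of `F : V → V*`; here `F u ∈ H*`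
means that the functional `F u` on `V` is the restriction of a bounded linear functional on `H`. -/
def friedrichDomain (V : Set H) (F : H → H → ℝ) : Set H :=
  {u ∈ V | ∃ ψ : StrongDual ℝ H, ∀ v ∈ V, ψ v = F u v}

open Classical in
/-- The Friedrich extension `u ↦ -γ⁻¹ (F u)`, where `γ : H → H*` is the Riesz isomorphism (the
value is `0` outside the domain). -/
def friedrich [CompleteSpace H] (V : Set H) (F : H → H → ℝ) (u : H) : H :=
  if h : u ∈ V ∧ ∃ ψ : StrongDual ℝ H, ∀ v ∈ V, ψ v = F u v then
    -(InnerProductSpace.toDual ℝ H).symm h.2.choose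
  else 0

open Classical in
/-- The resolvent `(I - h g)⁻¹ y` of the operator `g : D ⊆ H → H`, i.e. the solution `u ∈ D` of
`u - h g u = y`. -/
def nlResolvent (D : Set H) (g : H → H) (h : ℝ) (y : H) : H :=
  if hy : ∃ u, u ∈ D ∧ u - h • g u = y then hy.choose else 0

open Classical in
/-- `e^{tg} η = lim_{n → ∞} (I - (t/n) g)^{-n} η` for `t > 0`, and `e^{0g} η = η`. -/
def nlSemigroup (D : Set H) (g : H → H) (t : ℝ) (η : H) : H :=
  if t = 0 then η else limUnder atTop (fun n : ℕ => (nlResolvent D g (t / n))^[n] η)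

end Friedrich

section Concrete

variable {d k s : ℕ} {Ω : Opens (EuclideanSpace ℝ (Fin d))} {H : Type*}
  [NormedAddCommGroup H] [InnerProductSpace ℝ H]

/-- The weighted Lebesgue measure `χ_ℓ dx` on `Ω_ℓ`, so that `L^p(Ω_ℓ, χ_ℓ)` is `L^p` of it. -/
def DomainDecomposition.measure (P : DomainDecomposition Ω s) (ℓ : Fin s) :
    Measure (EuclideanSpace ℝ (Fin d)) :=
  (volume.restrict (P.dom ℓ)).withDensity fun x => ENNReal.ofReal (P.χ ℓ x)

/-- `(δ u)_j (φ)`. -/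
def fullFunctional (δ : H →ₗ[ℝ] (Fin k → 𝓓'(Ω, ℝ))) (u : H) (j : Fin k) (φ : 𝓓(Ω, ℝ)) : ℝ :=
  δ u j φ

/-- `(χ_ℓ δ u)_j (φ) = (δ u)_j (χ_ℓ φ)`. -/
def partFunctional (δ : H →ₗ[ℝ] (Fin k → 𝓓'(Ω, ℝ))) (P : DomainDecomposition Ω s) (ℓ : Fin s)
    (u : H) (j : Fin k) (φ : 𝓓(Ω, ℝ)) : ℝ :=
  δ u j (mulTest (P.χ ℓ) (P.smooth ℓ) φ)

/-- The space `V`. -/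
def fullSpace (p : ℝ) (δ : H →ₗ[ℝ] (Fin k → 𝓓'(Ω, ℝ))) : Set H :=
  energySpace p (volume.restrict Ω) (fullFunctional δ)

/-- The space `V_ℓ`. -/
def partSpace (p : ℝ) (δ : H →ₗ[ℝ] (Fin k → 𝓓'(Ω, ℝ))) (P : DomainDecomposition Ω s)
    (ℓ : Fin s) : Set H :=
  energySpace p (P.measure ℓ) (partFunctional δ P ℓ)

/-- `⟨F u, v⟩ = ∫_Ω α(δ_p u) · δ_p v dx` for `u, v ∈ V`. -/
def fullForm (p : ℝ)
    (α : EuclideanSpace ℝ (Fin d) → EuclideanSpace ℝ (Fin k) → EuclideanSpace ℝ (Fin k))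
    (δ : H →ₗ[ℝ] (Fin k → 𝓓'(Ω, ℝ))) : H → H → ℝ :=
  energyForm p α (volume.restrict Ω) (fullFunctional δ)

/-- `⟨F_ℓ u, v⟩ = ∫_{Ω_ℓ} χ_ℓ α(δ_{p,ℓ} u) · δ_{p,ℓ} v dx` for `u, v ∈ V_ℓ`. -/
def partForm (p : ℝ)
    (α : EuclideanSpace ℝ (Fin d) → EuclideanSpace ℝ (Fin k) → EuclideanSpace ℝ (Fin k))
    (δ : H →ₗ[ℝ] (Fin k → 𝓓'(Ω, ℝ))) (P : DomainDecomposition Ω s) (ℓ : Fin s) : H → H → ℝ :=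
  energyForm p α (P.measure ℓ) (partFunctional δ P ℓ)

/-- The domain `D(f)` of the Friedrich extension of the full vector field. -/
def fullDomain (p : ℝ)
    (α : EuclideanSpace ℝ (Fin d) → EuclideanSpace ℝ (Fin k) → EuclideanSpace ℝ (Fin k))
    (δ : H →ₗ[ℝ] (Fin k → 𝓓'(Ω, ℝ))) : Set H :=
  friedrichDomain (fullSpace p δ) (fullForm p α δ)

/-- The domain `D(f_ℓ)` of the Friedrich extension of the `ℓ`-th vector field. -/
def partDomain (p : ℝ)
    (α : EuclideanSpace ℝ (Fin d) → EuclideanSpace ℝ (Fin k) → EuclideanSpace ℝ (Fin k))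
    (δ : H →ₗ[ℝ] (Fin k → 𝓓'(Ω, ℝ))) (P : DomainDecomposition Ω s) (ℓ : Fin s) : Set H :=
  friedrichDomain (partSpace p δ P ℓ) (partForm p α δ P ℓ)

variable [CompleteSpace H]

/-- The Friedrich extension `f` of the full vector field. -/
def fullField (p : ℝ)
    (α : EuclideanSpace ℝ (Fin d) → EuclideanSpace ℝ (Fin k) → EuclideanSpace ℝ (Fin k))
    (δ : H →ₗ[ℝ] (Fin k → 𝓓'(Ω, ℝ))) : H → H :=
  friedrich (fullSpace p δ) (fullForm p α δ)

/-- The Friedrich extension `f_ℓ` of the `ℓ`-th decomposed vector field. -/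
def partField (p : ℝ)
    (α : EuclideanSpace ℝ (Fin d) → EuclideanSpace ℝ (Fin k) → EuclideanSpace ℝ (Fin k))
    (δ : H →ₗ[ℝ] (Fin k → 𝓓'(Ω, ℝ))) (P : DomainDecomposition Ω s) (ℓ : Fin s) : H → H :=
  friedrich (partSpace p δ P ℓ) (partForm p α δ P ℓ)

/-- One step `S_h = (1/s) ∑_ℓ (I - h s f_ℓ)⁻¹` of the sum splitting. -/
def sumSplitting (p : ℝ)
    (α : EuclideanSpace ℝ (Fin d) → EuclideanSpace ℝ (Fin k) → EuclideanSpace ℝ (Fin k))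
    (δ : H →ₗ[ℝ] (Fin k → 𝓓'(Ω, ℝ))) (P : DomainDecomposition Ω s) (h : ℝ) (u : H) : H :=
  (1 / (s : ℝ)) •
    ∑ ℓ, nlResolvent (partDomain p α δ P ℓ) (partField p α δ P ℓ) (h * s) u

end Concrete

end DomainSplitting

end

open DomainSplitting

/-!
The vector fields `f` and `f_ℓ` are Friedrich extensions of monotone, coercive energetic operators,
hence maximal dissipative on `H` (`isMaxDissipative_energy`). Solvability of `u - h f u = y` is the
theorem of Browder and Minty (`exists_apply_eq_zero_of_monotone`) on the closed graph of `u ↦ τ_p u`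
in `H × L^p`. Its finite part is a separation argument for matrices; the passage to infinitely many
test points needs no weak compactness, because the functional `‖u‖² + ‖g‖_p^p` is uniformly convex
on bounded sets, so that its almost minimizers over a directed family of closed convex sets form a
Cauchy net.

Gluing the local representing functions by the partition of unity shows that `f = ∑ ℓ, f_ℓ` on the
intersection of the domains of the `f_ℓ` (`fullField_eq_sum_partField`). On that intersection,
which by the range condition contains the resolvents of `f` at all points of the dense set `V`, the
generators `(S_h - I) / h` of the sum splitting are sums of Yosida approximations of the `f_ℓ` and
therefore converge to `f`.

What remains is a nonlinear Lax–Chernoff theorem. For a nonexpansive map `S_h` with generator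
`A = (S_h - I) / h`, the explicit scheme `S_h^n` and the implicit scheme `(I - l A)^{-m}` differ at
`x` by at most `‖A x‖ √((n h - m l)² + n h² + m l²)`
(`norm_iterate_sub_iterate_implicitStep_le`). For fixed `l`, consistency lets the implicit scheme
converge, as `h → 0`, to that of `f` with step size `l`, which is thus a common reference for all
consistent schemes. The scheme `(I - h f)⁻¹` is one of them, which yields the exponential formula;
the sum splitting is another, which yields its uniform convergence to the same limit.
-/

namespace DomainSplitting

/-! ### Maximal dissipative operators on a Hilbert space -/

section Dissipative

variable {H : Type*} [NormedAddCommGroup H] [InnerProductSpace ℝ H]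

/-- A single-valued operator `g` on `D` that is dissipative and maximal, the latter in the form of
Minty's criterion that every `I - h g`, `h > 0`, is onto. -/
structure IsMaxDissipative (D : Set H) (g : H → H) : Prop where
  dissipative : ∀ u ∈ D, ∀ v ∈ D, ⟪g u - g v, u - v⟫_ℝ ≤ 0
  surjective : ∀ h : ℝ, 0 < h → ∀ y, ∃ u, u ∈ D ∧ u - h • g u = y

/-- Dissipativity of `g` makes `I - h g` expansive. -/
theorem norm_sub_le_of_dissipative {D : Set H} {g : H → H}
    (hg : ∀ u ∈ D, ∀ v ∈ D, ⟪g u - g v, u - v⟫_ℝ ≤ 0) {h : ℝ} (hh : 0 ≤ h) {u v : H} (hu : u ∈ D)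
    (hv : v ∈ D) : ‖u - v‖ ≤ ‖(u - h • g u) - (v - h • g v)‖ := by
  have h1 := hg u hu v hv
  have h2 : (u - h • g u) - (v - h • g v) = (u - v) - h • (g u - g v) := by
    rw [smul_sub]; abel
  rw [h2]
  have h3 : ‖u - v‖ * ‖u - v‖ ≤ ‖u - v‖ * ‖(u - v) - h • (g u - g v)‖ := by
    refine le_trans ?_ (real_inner_le_norm _ _)
    rw [inner_sub_right, real_inner_self_eq_norm_mul_norm, inner_smul_right, real_inner_comm]
    nlinarith
  by_cases h0 : ‖u - v‖ = 0
  · rw [h0]; positivity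
  · exact le_of_mul_le_mul_left h3 (lt_of_le_of_ne (norm_nonneg _) (Ne.symm h0))

namespace IsMaxDissipative

variable {D : Set H} {g : H → H} (hg : IsMaxDissipative D g)
include hg

theorem existsUnique {h : ℝ} (hh : 0 < h) (y : H) : ∃! u, u ∈ D ∧ u - h • g u = y := by
  obtain ⟨u, hu, e⟩ := hg.surjective h hh y
  refine ⟨u, ⟨hu, e⟩, fun v hv => ?_⟩
  have := norm_sub_le_of_dissipative hg.dissipative hh.le hv.1 hu
  rw [hv.2, e, sub_self, norm_zero] at this
  exact sub_eq_zero.mp (norm_le_zero_iff.mp this)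

theorem nlResolvent_spec {h : ℝ} (hh : 0 < h) (y : H) :
    nlResolvent D g h y ∈ D ∧ nlResolvent D g h y - h • g (nlResolvent D g h y) = y := by
  have hy := hg.surjective h hh y
  rw [nlResolvent, dif_pos hy]
  exact hy.choose_spec

theorem nlResolvent_eq {h : ℝ} (hh : 0 < h) {u y : H} (hu : u ∈ D) (e : u - h • g u = y) :
    nlResolvent D g h y = u :=
  (hg.existsUnique hh y).unique (hg.nlResolvent_spec hh y) ⟨hu, e⟩

theorem norm_nlResolvent_sub_le {h : ℝ} (hh : 0 < h) (y z : H) :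
    ‖nlResolvent D g h y - nlResolvent D g h z‖ ≤ ‖y - z‖ := by
  have := norm_sub_le_of_dissipative hg.dissipative hh.le (hg.nlResolvent_spec hh y).1
    (hg.nlResolvent_spec hh z).1
  rwa [(hg.nlResolvent_spec hh y).2, (hg.nlResolvent_spec hh z).2] at this

/-- The Yosida approximation `(R_h - I) / h` is `g R_h`. -/
theorem smul_apply_nlResolvent {h : ℝ} (hh : 0 < h) (y : H) :
    h⁻¹ • (nlResolvent D g h y - y) = g (nlResolvent D g h y) := by
  have h1 := (hg.nlResolvent_spec hh y).2
  have h2 : nlResolvent D g h y - y = h • g (nlResolvent D g h y) := by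
    nth_rewrite 2 [← h1]; abel
  rw [h2, inv_smul_smul₀ hh.ne']

theorem norm_apply_nlResolvent_le {h : ℝ} (hh : 0 < h) {u : H} (hu : u ∈ D) :
    ‖g (nlResolvent D g h u)‖ ≤ ‖g u‖ := by
  have h1 := hg.norm_nlResolvent_sub_le hh u (u - h • g u)
  rw [hg.nlResolvent_eq hh hu rfl, sub_sub_cancel, norm_smul, Real.norm_of_nonneg hh.le] at h1
  rw [← hg.smul_apply_nlResolvent hh, norm_smul, norm_inv, Real.norm_of_nonneg hh.le]
  rwa [inv_mul_le_iff₀ hh]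

/-- With `a = g (R_h u)` and `b = g (R_k u)` the points of the graph are `R_h u = u + h a` and
`R_k u = u + k b`, so that dissipativity reads `⟪a - b, h a - k b⟫ ≤ 0`. -/
theorem norm_sq_apply_nlResolvent_sub_le {h k : ℝ} (hk : 0 < k) (hkh : k ≤ h) (u : H) :
    ‖g (nlResolvent D g h u) - g (nlResolvent D g k u)‖ ^ 2 ≤
      ‖g (nlResolvent D g k u)‖ ^ 2 - ‖g (nlResolvent D g h u)‖ ^ 2 := by
  have hh : 0 < h := hk.trans_le hkh
  have h0 := hg.dissipative _ (hg.nlResolvent_spec hh u).1 _ (hg.nlResolvent_spec hk u).1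
  have e1 := (hg.nlResolvent_spec hh u).2
  have e2 := (hg.nlResolvent_spec hk u).2
  set a := g (nlResolvent D g h u)
  set b := g (nlResolvent D g k u)
  have e3 : nlResolvent D g h u - nlResolvent D g k u = h • a - k • b := by
    rw [sub_eq_iff_eq_add] at e1 e2
    rw [e1, e2]; abel
  rw [e3, inner_sub_left, inner_sub_right, inner_sub_right, inner_smul_right, inner_smul_right,
    inner_smul_right, inner_smul_right, real_inner_self_eq_norm_sq, real_inner_self_eq_norm_sq,
    real_inner_comm a b] at h0
  rw [norm_sub_sq_real]
  set c := ⟪a, b⟫_ℝ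
  have hab : ‖a‖ ^ 2 ≤ ‖b‖ ^ 2 := by
    have hc : c ≤ ‖a‖ * ‖b‖ := real_inner_le_norm a b
    have : (h * ‖a‖ - k * ‖b‖) * (‖a‖ - ‖b‖) ≤ 0 := by nlinarith
    by_contra! hlt
    have hlt' : ‖b‖ < ‖a‖ := lt_of_pow_lt_pow_left₀ 2 (norm_nonneg _) hlt
    have : 0 < h * ‖a‖ - k * ‖b‖ := by nlinarith [norm_nonneg b, norm_nonneg a]
    nlinarith
  have h1 : (h + k) * ‖a‖ ^ 2 ≤ (h + k) * c := by
    have : (h - k) * ‖a‖ ^ 2 ≤ (h - k) * ‖b‖ ^ 2 := by gcongr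
    nlinarith
  have := le_of_mul_le_mul_left h1 (by positivity)
  linarith

/-- The Yosida approximations of a maximal dissipative operator converge to it on its domain: by
`norm_sq_apply_nlResolvent_sub_le` their norms are monotone and they form a Cauchy family, and the
graph of the operator is closed. -/
theorem tendsto_smul_nlResolvent_sub [CompleteSpace H] {u : H} (hu : u ∈ D) :
    Tendsto (fun h : ℝ => h⁻¹ • (nlResolvent D g h u - u)) (𝓝[>] 0) (𝓝 (g u)) := by
  suffices hs : Tendsto (fun h : ℝ => g (nlResolvent D g h u)) (𝓝[>] 0) (𝓝 (g u)) by
    refine hs.congr' ?_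
    filter_upwards [self_mem_nhdsWithin] with h hh
    exact (hg.smul_apply_nlResolvent hh u).symm
  set a : ℝ → H := fun h => g (nlResolvent D g h u) with ha
  have hanti : AntitoneOn (fun h => ‖a h‖ ^ 2) (Ioi 0) := fun k hk h _ hkh => by
    have := hg.norm_sq_apply_nlResolvent_sub_le hk hkh u
    have h2 : 0 ≤ ‖g (nlResolvent D g h u) - g (nlResolvent D g k u)‖ ^ 2 := by positivity
    simp only [ha]; linarith
  have hbdd : BddAbove ((fun h => ‖a h‖ ^ 2) '' Ioi 0) := by
    refine ⟨‖g u‖ ^ 2, ?_⟩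
    rintro _ ⟨h, hh, rfl⟩
    have := hg.norm_apply_nlResolvent_le hh hu
    dsimp only [ha]
    gcongr
  have hN : Tendsto (fun h => ‖a h‖ ^ 2) (𝓝[>] 0) (𝓝 (sSup ((fun h => ‖a h‖ ^ 2) '' Ioi 0))) :=
    hanti.tendsto_nhdsGT hbdd
  have hcauchy : Cauchy (map a (𝓝[>] 0)) := by
    rw [Metric.cauchy_iff]
    refine ⟨inferInstance, fun ε hε => ?_⟩
    obtain ⟨s, hs, hs2⟩ := (Metric.cauchy_iff.mp hN.cauchy_map).2 (ε ^ 2) (by positivity)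
    refine ⟨a '' ((fun h => ‖a h‖ ^ 2) ⁻¹' s ∩ Ioi 0),
      image_mem_map (inter_mem hs self_mem_nhdsWithin), ?_⟩
    rintro _ ⟨h, ⟨hh, h0⟩, rfl⟩ _ ⟨k, ⟨hk, k0⟩, rfl⟩
    have hd := hs2 _ hh _ hk
    rw [Real.dist_eq, abs_lt] at hd
    rw [dist_eq_norm]
    refine lt_of_pow_lt_pow_left₀ 2 hε.le ?_
    rcases le_total k h with hkh | hkh
    · have := hg.norm_sq_apply_nlResolvent_sub_le k0 hkh u
      simp only [ha] at hd ⊢; linarith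
    · have := hg.norm_sq_apply_nlResolvent_sub_le h0 hkh u
      rw [norm_sub_rev]
      simp only [ha] at hd ⊢; linarith
  obtain ⟨b, hb⟩ := CompleteSpace.complete hcauchy
  have hb : Tendsto a (𝓝[>] 0) (𝓝 b) := hb
  -- the graph of `g` is closed, since the resolvent is continuous
  have hid : Tendsto (fun h : ℝ => h) (𝓝[>] 0) (𝓝 0) :=
    tendsto_nhdsWithin_of_tendsto_nhds tendsto_id
  have hR : Tendsto (fun h => u + h • a h) (𝓝[>] 0) (𝓝 u) := by
    simpa using (tendsto_const_nhds (x := u)).add (hid.smul hb)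
  have hR' : Tendsto (fun h => nlResolvent D g h u) (𝓝[>] 0) (𝓝 u) := by
    refine hR.congr' ?_
    filter_upwards [self_mem_nhdsWithin] with h hh
    have := (hg.nlResolvent_spec hh u).2
    rw [sub_eq_iff_eq_add] at this
    exact this.symm
  have hcont : Continuous (nlResolvent D g 1) :=
    (LipschitzWith.of_dist_le_mul (K := 1) fun x y => by
      simpa [dist_eq_norm] using hg.norm_nlResolvent_sub_le one_pos x y).continuous
  have h1 : Tendsto (fun h => nlResolvent D g 1 (nlResolvent D g h u - (1 : ℝ) • a h)) (𝓝[>] 0)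
      (𝓝 (nlResolvent D g 1 (u - (1 : ℝ) • b))) :=
    (hcont.tendsto _).comp (hR'.sub (hb.const_smul (1 : ℝ)))
  have h2 : nlResolvent D g 1 (u - (1 : ℝ) • b) = u := by
    refine tendsto_nhds_unique h1 (hR'.congr' ?_)
    filter_upwards [self_mem_nhdsWithin] with h hh
    exact (hg.nlResolvent_eq one_pos (hg.nlResolvent_spec hh u).1 rfl).symm
  have h3 := (hg.nlResolvent_spec one_pos (u - (1 : ℝ) • b)).2
  rw [h2, one_smul, one_smul, sub_right_inj] at h3
  rwa [h3]

end IsMaxDissipative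

end Dissipative

/-! ### Explicit and implicit Euler schemes of a nonexpansive map -/

section ProductFormula

variable {H : Type*} [NormedAddCommGroup H] [NormedSpace ℝ H]

/-- The implicit Euler step `(I - l A)⁻¹` of size `l` for the generator `A = (T - I) / h` of a
map `T`, as a solution of the equation `z - l A z = y` multiplied by `h / (h + l)`. -/
noncomputable def implicitStep (T : H → H) (h l : ℝ) (y : H) : H :=
  Classical.epsilon fun z => z = (h / (h + l)) • y + (l / (h + l)) • T z

variable {T : H → H} {h l : ℝ}

theorem implicitStep_eq [CompleteSpace H] (hT : ∀ x y, ‖T x - T y‖ ≤ ‖x - y‖) (hh : 0 < h)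
    (hl : 0 < l) (y : H) :
    implicitStep T h l y = (h / (h + l)) • y + (l / (h + l)) • T (implicitStep T h l y) := by
  have hlt : l / (h + l) < 1 := by rw [div_lt_one (by positivity)]; linarith
  have hc : ContractingWith (l / (h + l)).toNNReal
      (fun z => (h / (h + l)) • y + (l / (h + l)) • T z) := by
    refine ⟨by rwa [Real.toNNReal_lt_one], LipschitzWith.of_dist_le_mul fun a b => ?_⟩
    rw [dist_eq_norm, dist_eq_norm, add_sub_add_left_eq_sub, ← smul_sub, norm_smul,
      Real.coe_toNNReal _ (by positivity), Real.norm_of_nonneg (by positivity)]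
    gcongr
    exact hT a b
  have : ∃ z, z = (h / (h + l)) • y + (l / (h + l)) • T z :=
    ⟨hc.fixedPoint, hc.fixedPoint_isFixedPt.symm⟩
  exact Classical.epsilon_spec this

variable [CompleteSpace H] (hT : ∀ x y, ‖T x - T y‖ ≤ ‖x - y‖) (hh : 0 < h) (hl : 0 < l)
include hT hh hl

theorem smul_implicitStep (y : H) :
    (h + l) • implicitStep T h l y = h • y + l • T (implicitStep T h l y) := by
  nth_rewrite 1 [implicitStep_eq hT hh hl y]
  rw [smul_add, smul_smul, smul_smul, mul_div_cancel₀ _ (by positivity),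
    mul_div_cancel₀ _ (by positivity)]

theorem norm_implicitStep_sub_le (x y : H) :
    ‖implicitStep T h l x - implicitStep T h l y‖ ≤ ‖x - y‖ := by
  have e : (h + l) • (implicitStep T h l x - implicitStep T h l y) =
      h • (x - y) + l • (T (implicitStep T h l x) - T (implicitStep T h l y)) := by
    rw [smul_sub, smul_implicitStep hT hh hl, smul_implicitStep hT hh hl, smul_sub, smul_sub]
    abel
  have h1 := congrArg norm e
  have h2 := norm_add_le (h • (x - y)) (l • (T (implicitStep T h l x) - T (implicitStep T h l y)))
  rw [norm_smul, Real.norm_of_nonneg (by positivity)] at h1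
  rw [norm_smul, norm_smul, Real.norm_of_nonneg hh.le, Real.norm_of_nonneg hl.le] at h2
  have h3 := mul_le_mul_of_nonneg_left (hT (implicitStep T h l x) (implicitStep T h l y)) hl.le
  refine le_of_mul_le_mul_left ?_ hh
  linarith

theorem norm_iterate_implicitStep_sub_le (m : ℕ) (x y : H) :
    ‖(implicitStep T h l)^[m] x - (implicitStep T h l)^[m] y‖ ≤ ‖x - y‖ := by
  induction m with
  | zero => simp
  | succ m ih =>
    rw [Function.iterate_succ_apply', Function.iterate_succ_apply']
    exact (norm_implicitStep_sub_le hT hh hl _ _).trans ih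

/-- At `z = (I - l A)⁻¹ y` one has `A z = (z - y) / l`. -/
theorem norm_apply_implicitStep_sub (y : H) :
    ‖T (implicitStep T h l y) - implicitStep T h l y‖ * l = h * ‖implicitStep T h l y - y‖ := by
  have e : l • (T (implicitStep T h l y) - implicitStep T h l y) =
      h • (implicitStep T h l y - y) := by
    have := smul_implicitStep hT hh hl y
    rw [add_smul] at this
    rw [smul_sub, smul_sub, sub_eq_sub_iff_add_eq_add, add_comm, ← this]
  have := congrArg norm e
  rw [norm_smul, norm_smul, Real.norm_of_nonneg hh.le, Real.norm_of_nonneg hl.le] at this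
  linarith

/-- The implicit step moves `y` by at most `l ‖A y‖`. -/
theorem norm_implicitStep_sub_self_le (y : H) :
    ‖implicitStep T h l y - y‖ * h ≤ l * ‖T y - y‖ := by
  set z := implicitStep T h l y with hz
  have e : (h + l) • (z - y) = l • (T z - T y) + l • (T y - y) := by
    rw [smul_sub, smul_implicitStep hT hh hl, add_smul, smul_sub, smul_sub]; abel
  have h1 := congrArg norm e
  have h2 := norm_add_le (l • (T z - T y)) (l • (T y - y))
  rw [norm_smul, Real.norm_of_nonneg (by positivity)] at h1
  rw [norm_smul, norm_smul, Real.norm_of_nonneg hl.le] at h2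
  have h3 := mul_le_mul_of_nonneg_left (hT z y) hl.le
  linarith

/-- Comparison of the explicit and the implicit Euler scheme for `A = (T - I) / h`, with step sizes
`h` and `l`. The right hand side `√(e² + n h² + m l²)`, with `e = n h - m l`, dominates because
`e² + n h² + m l²` is exactly the convex combination, with the weights `h / (h + l)` and
`l / (h + l)`, of its values at `(n, m - 1)` and `(n - 1, m)`. -/
theorem norm_iterate_sub_iterate_implicitStep_le (x : H) (n m : ℕ) :
    ‖T^[n] x - (implicitStep T h l)^[m] x‖ ≤
      ‖T x - x‖ / h * √((n * h - m * l) ^ 2 + n * h * h + m * l * l) := by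
  have hL : 0 ≤ ‖T x - x‖ / h := by positivity
  have hit : ∀ n : ℕ, ‖T^[n] x - x‖ ≤ ‖T x - x‖ / h * (n * h) := by
    intro n
    have : ‖T^[n] x - x‖ ≤ n * ‖T x - x‖ := by
      induction n with
      | zero => simp
      | succ n ih =>
        rw [Function.iterate_succ_apply']
        calc ‖T (T^[n] x) - x‖ ≤ ‖T (T^[n] x) - T x‖ + ‖T x - x‖ :=
              norm_sub_le_norm_sub_add_norm_sub _ _ _
          _ ≤ n * ‖T x - x‖ + ‖T x - x‖ := by gcongr; exact (hT _ _).trans ih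
          _ = _ := by push_cast; ring
    rwa [show ‖T x - x‖ / h * (n * h) = n * ‖T x - x‖ by field_simp]
  have hz : ∀ m : ℕ, ‖(implicitStep T h l)^[m] x - x‖ ≤ ‖T x - x‖ / h * (m * l) := by
    intro m
    induction m with
    | zero => simp
    | succ m ih =>
      rw [Function.iterate_succ_apply']
      have h1 : ‖implicitStep T h l x - x‖ ≤ ‖T x - x‖ / h * l := by
        have := norm_implicitStep_sub_self_le hT hh hl x
        rw [← le_div_iff₀ hh] at this
        exact this.trans (le_of_eq (by ring))
      calc _ ≤ ‖implicitStep T h l ((implicitStep T h l)^[m] x) - implicitStep T h l x‖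
            + ‖implicitStep T h l x - x‖ := norm_sub_le_norm_sub_add_norm_sub _ _ _
        _ ≤ ‖T x - x‖ / h * (m * l) + ‖T x - x‖ / h * l := by
            gcongr
            exact (norm_implicitStep_sub_le hT hh hl _ _).trans ih
        _ = _ := by push_cast; ring
  induction n generalizing m with
  | zero =>
    rw [Function.iterate_zero_apply, norm_sub_rev]
    refine (hz m).trans ?_
    gcongr
    apply Real.le_sqrt_of_sq_le
    have : 0 ≤ (m : ℝ) * l * l := by positivity
    simp only [CharP.cast_eq_zero]
    nlinarith
  | succ n ihn =>
    induction m with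
    | zero =>
      rw [Function.iterate_zero_apply]
      refine (hit _).trans ?_
      gcongr
      apply Real.le_sqrt_of_sq_le
      have : 0 ≤ ((n + 1 : ℕ) : ℝ) * h * h := by positivity
      simp only [CharP.cast_eq_zero]
      nlinarith
    | succ m ihm =>
      set u := T^[n + 1] x with hu
      have e1 := ihn (m + 1)
      rw [Function.iterate_succ_apply'] at e1 ⊢
      set w := (implicitStep T h l)^[m] x
      set z := implicitStep T h l w with hzz
      have e : (h + l) • (u - z) = h • (u - w) + l • (T (T^[n] x) - T z) := by
        rw [smul_sub, smul_implicitStep hT hh hl, add_smul, smul_sub, smul_sub,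
          ← Function.iterate_succ_apply' T n x, ← hu]
        abel
      have h1 := congrArg norm e
      have h2 := norm_add_le (h • (u - w)) (l • (T (T^[n] x) - T z))
      rw [norm_smul, Real.norm_of_nonneg (by positivity)] at h1
      rw [norm_smul, norm_smul, Real.norm_of_nonneg hl.le, Real.norm_of_nonneg hh.le] at h2
      have h3 := mul_le_mul_of_nonneg_left ((hT _ _).trans e1) hl.le
      have h4 := mul_le_mul_of_nonneg_left ihm hh.le
      set L := ‖T x - x‖ / h
      set P := (((n + 1 : ℕ) : ℝ) * h - (m : ℝ) * l) ^ 2 + ((n + 1 : ℕ) : ℝ) * h * h + m * l * l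
        with hP
      set Q := ((n : ℝ) * h - ((m + 1 : ℕ) : ℝ) * l) ^ 2 + (n : ℝ) * h * h +
        ((m + 1 : ℕ) : ℝ) * l * l with hQ
      have hP0 : 0 ≤ P := by positivity
      have hQ0 : 0 ≤ Q := by positivity
      set R := (((n + 1 : ℕ) : ℝ) * h - ((m + 1 : ℕ) : ℝ) * l) ^ 2 + ((n + 1 : ℕ) : ℝ) * h * h +
        ((m + 1 : ℕ) : ℝ) * l * l with hR
      have hPQ : (h + l) * R = h * P + l * Q := by
        rw [hP, hQ, hR]; push_cast; ring
      have key : h * √P + l * √Q ≤ (h + l) * √R := by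
        have hR0 : 0 ≤ R := by positivity
        have : h * √P + l * √Q ≤ √((h + l) * (h * P + l * Q)) := by
          apply Real.le_sqrt_of_sq_le
          have a1 := Real.sq_sqrt hP0
          have a2 := Real.sq_sqrt hQ0
          have a3 : (h + l) * (h * P + l * Q) - (h * √P + l * √Q) ^ 2 = h * l * (√P - √Q) ^ 2 := by
            linear_combination (-(h + l) * h) * a1 - (h + l) * l * a2
          have a4 : 0 ≤ h * l * (√P - √Q) ^ 2 := by positivity
          linarith
        rw [← hPQ, ← mul_assoc, Real.sqrt_mul (by positivity), Real.sqrt_mul_self (by positivity)]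
          at this
        linarith
      have h5 := mul_le_mul_of_nonneg_left key hL
      refine le_of_mul_le_mul_left ?_ (show 0 < h + l by positivity)
      calc (h + l) * ‖u - z‖ ≤ h * ‖u - w‖ + l * ‖T (T^[n] x) - T z‖ := by rw [h1]; exact h2
        _ ≤ h * (L * √P) + l * (L * √Q) := add_le_add h4 h3
        _ = L * (h * √P + l * √Q) := by ring
        _ ≤ L * ((h + l) * √R) := h5
        _ = _ := by ring

end ProductFormula

/-! ### The exponential formula and convergence of consistent schemes -/

section Convergence

variable {H : Type*} [NormedAddCommGroup H] [InnerProductSpace ℝ H]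

/-- A family `S h`, `h > 0`, of nonexpansive maps whose generators `(S h - I) / h` converge to `g`
as `h → 0`, at the solutions `u` of `u - l g u = v` for all `l > 0` and a dense set of `v`. -/
structure IsConsistent (D : Set H) (g : H → H) (S : ℝ → H → H) : Prop where
  nonexpansive : ∀ h, 0 < h → ∀ x y, ‖S h x - S h y‖ ≤ ‖x - y‖
  tendsto : ∃ W : Set H, Dense W ∧ ∀ v ∈ W, ∀ l : ℝ, 0 < l →
    Tendsto (fun h : ℝ => h⁻¹ • (S h (nlResolvent D g l v) - nlResolvent D g l v)) (𝓝[>] 0)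
      (𝓝 (g (nlResolvent D g l v)))

namespace IsMaxDissipative

variable {D : Set H} {g : H → H}

theorem isConsistent_nlResolvent [CompleteSpace H] (hg : IsMaxDissipative D g) :
    IsConsistent D g (nlResolvent D g) where
  nonexpansive _ hh := hg.norm_nlResolvent_sub_le hh
  tendsto := ⟨univ, dense_univ, fun v _ _ hl =>
    hg.tendsto_smul_nlResolvent_sub (hg.nlResolvent_spec hl v).1⟩

theorem norm_iterate_nlResolvent_sub_le (hg : IsMaxDissipative D g) {l : ℝ} (hl : 0 < l) (m : ℕ)
    (x y : H) : ‖(nlResolvent D g l)^[m] x - (nlResolvent D g l)^[m] y‖ ≤ ‖x - y‖ := by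
  induction m with
  | zero => simp
  | succ m ih =>
    rw [Function.iterate_succ_apply', Function.iterate_succ_apply']
    exact (hg.norm_nlResolvent_sub_le hl _ _).trans ih

end IsMaxDissipative

namespace IsConsistent

variable {D : Set H} {g : H → H} {S : ℝ → H → H}

theorem norm_iterate_sub_le (hS : IsConsistent D g S) {h : ℝ} (hh : 0 < h) (n : ℕ)
    (x y : H) : ‖(S h)^[n] x - (S h)^[n] y‖ ≤ ‖x - y‖ := by
  induction n with
  | zero => simp
  | succ m ih =>
    rw [Function.iterate_succ_apply', Function.iterate_succ_apply']
    exact (hS.nonexpansive h hh _ _).trans ih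

variable [CompleteSpace H] (hg : IsMaxDissipative D g) (hS : IsConsistent D g S)
include hg hS

/-- Consistency implies convergence of the resolvents of the generators `(S h - I) / h`. -/
theorem tendsto_implicitStep {l : ℝ} (hl : 0 < l) (y : H) :
    Tendsto (fun h => implicitStep (S h) h l y) (𝓝[>] 0) (𝓝 (nlResolvent D g l y)) := by
  obtain ⟨W, hW, hcons⟩ := hS.tendsto
  rw [Metric.tendsto_nhds]
  intro ε hε
  obtain ⟨v, hv, hvy⟩ := Metric.mem_closure_iff.mp (hW y) (ε / 3) (by positivity)
  rw [dist_eq_norm] at hvy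
  filter_upwards [Metric.tendsto_nhds.mp (hcons v hv l hl) (ε / 3 / l) (by positivity),
    self_mem_nhdsWithin] with h h1 (hh : 0 < h)
  rw [dist_eq_norm] at h1 ⊢
  have hT := hS.nonexpansive h hh
  set u := nlResolvent D g l v with hu
  set z := implicitStep (S h) h l v with hz
  have h2 : ‖z - u‖ ≤ l * ‖h⁻¹ • (S h u - u) - g u‖ := by
    have e : (h + l) • (z - u) = l • (S h z - S h u) + (l * h) • (h⁻¹ • (S h u - u) - g u) := by
      have e1 : h • v = h • u - (h * l) • g u := by
        rw [← smul_smul, ← smul_sub, hu, (hg.nlResolvent_spec hl v).2]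
      rw [smul_sub, smul_implicitStep hT hh hl, ← hz, e1, mul_comm l h, smul_sub (h * l), smul_smul,
        show h * l * h⁻¹ = l by field_simp, smul_sub, smul_sub, add_smul]
      abel
    have h1 := congrArg norm e
    have h2 := norm_add_le (l • (S h z - S h u)) ((l * h) • (h⁻¹ • (S h u - u) - g u))
    rw [norm_smul, Real.norm_of_nonneg (by positivity)] at h1
    rw [norm_smul, norm_smul (l * h), Real.norm_of_nonneg hl.le,
      Real.norm_of_nonneg (by positivity)] at h2
    have h3 := mul_le_mul_of_nonneg_left (hT z u) hl.le
    refine le_of_mul_le_mul_left ?_ hh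
    linarith
  have h3 : l * ‖h⁻¹ • (S h u - u) - g u‖ < ε / 3 := by rwa [lt_div_iff₀' hl] at h1
  have h4 := norm_implicitStep_sub_le hT hh hl y v
  have h5 := hg.norm_nlResolvent_sub_le hl v y
  rw [norm_sub_rev v y] at h5
  calc ‖implicitStep (S h) h l y - nlResolvent D g l y‖
      = ‖(implicitStep (S h) h l y - z) + (z - u) + (u - nlResolvent D g l y)‖ := by congr 1; abel
    _ ≤ ‖implicitStep (S h) h l y - z‖ + ‖z - u‖ + ‖u - nlResolvent D g l y‖ := norm_add₃_le
    _ < ε := by linarith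

theorem tendsto_iterate_implicitStep {l : ℝ} (hl : 0 < l) (y : H) (m : ℕ) :
    Tendsto (fun h => (implicitStep (S h) h l)^[m] y) (𝓝[>] 0)
      (𝓝 ((nlResolvent D g l)^[m] y)) := by
  induction m with
  | zero => exact tendsto_const_nhds
  | succ m ih =>
    simp_rw [Function.iterate_succ_apply']
    have h1 := hS.tendsto_implicitStep hg hl ((nlResolvent D g l)^[m] y)
    rw [tendsto_iff_norm_sub_tendsto_zero] at ih h1 ⊢
    refine squeeze_zero' (Eventually.of_forall fun _ => norm_nonneg _) ?_
      (by simpa using ih.add h1)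
    filter_upwards [self_mem_nhdsWithin] with h hh
    refine (norm_sub_le_norm_sub_add_norm_sub _ (implicitStep (S h) h l
      ((nlResolvent D g l)^[m] y)) _).trans ?_
    gcongr
    exact norm_implicitStep_sub_le (hS.nonexpansive h hh) hh hl _ _

/-- For fixed `l`, the comparison of the explicit scheme `(S h)^n` with the implicit scheme of step
size `l` for the same generator passes to the limit `h → 0`, in which the implicit scheme becomes
that of `g`. -/
theorem eventually_norm_iterate_sub_lt_of_mem {x : H} (hx : x ∈ D) {T l ε : ℝ} (hl : 0 < l)
    (hε : ‖g x‖ * √(l ^ 2 + T * l) < ε) :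
    ∀ᶠ h : ℝ in 𝓝[>] 0, ∀ n : ℕ, n * h < T →
      ‖(S h)^[n] x - (nlResolvent D g l)^[⌊n * h / l⌋₊] x‖ < ε := by
  -- `x` is approximated by `(I - A)⁻¹ y` with `A = (S h - I) / h`, at which `A` stays bounded
  set y := x - (1 : ℝ) • g x with hy
  have hxy : nlResolvent D g 1 y = x := hg.nlResolvent_eq one_pos hx rfl
  have hlim : Tendsto (fun h => implicitStep (S h) h 1 y) (𝓝[>] 0) (𝓝 x) := by
    simpa [hxy] using hS.tendsto_implicitStep hg one_pos y
  have hL : Tendsto (fun h => ‖implicitStep (S h) h 1 y - y‖) (𝓝[>] 0) (𝓝 ‖g x‖) := by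
    have : ‖x - y‖ = ‖g x‖ := by rw [hy, one_smul, sub_sub_cancel]
    rw [← this]
    exact (hlim.sub_const y).norm
  have hsq : Tendsto (fun h : ℝ => √(l ^ 2 + T * h + T * l)) (𝓝[>] 0) (𝓝 √(l ^ 2 + T * l)) := by
    have : Continuous fun h : ℝ => √(l ^ 2 + T * h + T * l) := by fun_prop
    simpa using (this.tendsto 0).mono_left nhdsWithin_le_nhds
  obtain ⟨κ, hκ, hκε⟩ : ∃ κ : ℝ, 0 < κ ∧ ‖g x‖ * √(l ^ 2 + T * l) + 3 * κ < ε :=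
    ⟨(ε - ‖g x‖ * √(l ^ 2 + T * l)) / 4, by linarith, by linarith⟩
  have hx' : ∀ᶠ h : ℝ in 𝓝[>] 0, ‖implicitStep (S h) h 1 y - x‖ < κ := by
    filter_upwards [Metric.tendsto_nhds.mp hlim κ hκ] with h hh
    rwa [dist_eq_norm] at hh
  have hall : ∀ᶠ h : ℝ in 𝓝[>] 0, ∀ m ∈ Finset.range (⌊T / l⌋₊ + 1),
      ‖(implicitStep (S h) h l)^[m] x - (nlResolvent D g l)^[m] x‖ < κ := by
    rw [Finset.eventually_all]
    intro m _
    filter_upwards [Metric.tendsto_nhds.mp (hS.tendsto_iterate_implicitStep hg hl x m) κ hκ]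
      with h hh
    rwa [dist_eq_norm] at hh
  have hmain : ∀ᶠ h : ℝ in 𝓝[>] 0,
      ‖implicitStep (S h) h 1 y - y‖ * √(l ^ 2 + T * h + T * l) + 3 * κ < ε :=
    ((hL.mul hsq).add_const (3 * κ)).eventually_lt_const hκε
  filter_upwards [hx', hall, hmain, self_mem_nhdsWithin] with h h1 h2 h3 (hh : 0 < h) n hn
  have hT := hS.nonexpansive h hh
  set xh := implicitStep (S h) h 1 y with hxh
  -- `m l` is the last time of the coarse grid before `n h`, whence `|n h - m l| ≤ l`
  set m := ⌊n * h / l⌋₊ with hm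
  have hml : m * l ≤ n * h := by
    rw [← le_div_iff₀ hl]; exact Nat.floor_le (by positivity)
  have hml' : n * h < (m + 1) * l := by
    rw [← div_lt_iff₀ hl]; exact Nat.lt_floor_add_one _
  have hmem : m ∈ Finset.range (⌊T / l⌋₊ + 1) := by
    rw [Finset.mem_range, Nat.lt_succ_iff]
    exact Nat.floor_le_floor (by gcongr)
  have hgen : ‖S h xh - xh‖ / h = ‖xh - y‖ := by
    have := norm_apply_implicitStep_sub hT hh one_pos y
    rw [mul_one] at this
    rw [this, mul_div_cancel_left₀ _ hh.ne']
  have hcmp := norm_iterate_sub_iterate_implicitStep_le hT hh hl xh n m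
  rw [hgen] at hcmp
  have hle : ‖xh - y‖ * √((n * h - m * l) ^ 2 + n * h * h + m * l * l) ≤
      ‖xh - y‖ * √(l ^ 2 + T * h + T * l) := by
    have a1 : (n * h - m * l) ^ 2 ≤ l ^ 2 :=
      pow_le_pow_left₀ (by linarith) (by linarith) 2
    have a2 : n * h * h ≤ T * h := by gcongr
    have a3 : m * l * l ≤ T * l := by gcongr; linarith
    gcongr
  have h4 := hS.norm_iterate_sub_le hh n x xh
  have h5 := norm_iterate_implicitStep_sub_le hT hh hl m xh x
  have h6 := h2 m hmem
  rw [norm_sub_rev x xh] at h4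
  calc ‖(S h)^[n] x - (nlResolvent D g l)^[m] x‖
      = ‖((S h)^[n] x - (S h)^[n] xh) + ((S h)^[n] xh - (implicitStep (S h) h l)^[m] xh)
          + ((implicitStep (S h) h l)^[m] xh - (implicitStep (S h) h l)^[m] x)
          + ((implicitStep (S h) h l)^[m] x - (nlResolvent D g l)^[m] x)‖ := by congr 1; abel
    _ ≤ _ := norm_add₄_le
    _ < ε := by linarith

end IsConsistent

namespace IsMaxDissipative

variable {D : Set H} {g : H → H} [CompleteSpace H] (hg : IsMaxDissipative D g) (hD : Dense D)
include hg hD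

/-- The step size `l` depends on `η`, `T` and `ε` only, so that the implicit Euler scheme for `g`
with this step size serves as a common reference for all consistent schemes. -/
theorem exists_step_eventually_norm_iterate_sub_lt (η : H) (T : ℝ) {ε : ℝ} (hε : 0 < ε) :
    ∃ l : ℝ, 0 < l ∧ ∀ S : ℝ → H → H, IsConsistent D g S → ∀ᶠ h : ℝ in 𝓝[>] 0, ∀ n : ℕ,
      n * h < T → ‖(S h)^[n] η - (nlResolvent D g l)^[⌊n * h / l⌋₊] η‖ < ε := by
  obtain ⟨x, hx, hxη⟩ := Metric.mem_closure_iff.mp (hD η) (ε / 3) (by positivity)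
  rw [dist_eq_norm] at hxη
  obtain ⟨l, hl, hlε⟩ : ∃ l : ℝ, 0 < l ∧ ‖g x‖ * √(l ^ 2 + T * l) < ε / 3 := by
    have hc : Continuous fun l : ℝ => ‖g x‖ * √(l ^ 2 + T * l) := by fun_prop
    have h0 : Tendsto (fun l : ℝ => ‖g x‖ * √(l ^ 2 + T * l)) (𝓝[>] 0) (𝓝 0) := by
      simpa using (hc.tendsto 0).mono_left nhdsWithin_le_nhds
    exact (eventually_mem_nhdsWithin.and
      (h0.eventually_lt_const (show 0 < ε / 3 by positivity))).exists
  refine ⟨l, hl, fun S hS => ?_⟩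
  filter_upwards [hS.eventually_norm_iterate_sub_lt_of_mem hg hx hl hlε, self_mem_nhdsWithin]
    with h h1 hh n hn
  have h2 := h1 n hn
  have h3 := hS.norm_iterate_sub_le hh n η x
  have h4 := hg.norm_iterate_nlResolvent_sub_le hl ⌊n * h / l⌋₊ x η
  rw [norm_sub_rev x η] at h4
  calc ‖(S h)^[n] η - (nlResolvent D g l)^[⌊n * h / l⌋₊] η‖
      = ‖((S h)^[n] η - (S h)^[n] x) + ((S h)^[n] x - (nlResolvent D g l)^[⌊n * h / l⌋₊] x)
          + ((nlResolvent D g l)^[⌊n * h / l⌋₊] x - (nlResolvent D g l)^[⌊n * h / l⌋₊] η)‖ := by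
        congr 1; abel
    _ ≤ _ := norm_add₃_le
    _ < ε := by linarith

theorem exists_step_eventually_forall_norm_sub_lt (η : H) (T : ℝ) {ε : ℝ} (hε : 0 < ε) :
    ∃ l : ℝ, 0 < l ∧ ∀ S : ℝ → H → H, IsConsistent D g S → ∀ᶠ n : ℕ in atTop, ∀ t ∈ Ioo 0 T,
      ‖(S (t / n))^[n] η - (nlResolvent D g l)^[⌊t / l⌋₊] η‖ < ε := by
  obtain ⟨l, hl, h⟩ := hg.exists_step_eventually_norm_iterate_sub_lt hD η T hε
  refine ⟨l, hl, fun S hS => ?_⟩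
  obtain ⟨κ, hκ, hκS⟩ := mem_nhdsGT_iff_exists_Ioo_subset.mp (h S hS)
  have hlim : Tendsto (fun n : ℕ => T / n) atTop (𝓝 0) := tendsto_const_div_atTop_nhds_zero_nat T
  filter_upwards [hlim.eventually_lt_const (show 0 < κ from hκ), eventually_gt_atTop 0]
    with n hn hn0 t ht
  have hn0' : (0 : ℝ) < n := by exact_mod_cast hn0
  have h1 : t / n ∈ Ioo 0 κ := ⟨div_pos ht.1 hn0', lt_of_le_of_lt (by gcongr; exact ht.2.le) hn⟩
  have h2 := hκS h1 n
  rw [mul_div_cancel₀ _ hn0'.ne'] at h2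
  exact h2 ht.2

/-- The exponential formula of Crandall and Liggett. -/
theorem tendsto_nlSemigroup {t : ℝ} (ht : 0 < t) (η : H) :
    Tendsto (fun n : ℕ => (nlResolvent D g (t / n))^[n] η) atTop (𝓝 (nlSemigroup D g t η)) := by
  rw [nlSemigroup, if_neg ht.ne']
  refine tendsto_nhds_limUnder (cauchySeq_tendsto_of_complete ?_)
  rw [Metric.cauchySeq_iff']
  intro ε hε
  obtain ⟨l, hl, h⟩ := hg.exists_step_eventually_forall_norm_sub_lt hD η (t + 1) (half_pos hε)
  obtain ⟨N, hN⟩ := eventually_atTop.mp (h _ hg.isConsistent_nlResolvent)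
  refine ⟨N, fun n hn => ?_⟩
  have ht' : t ∈ Ioo 0 (t + 1) := ⟨ht, lt_add_one t⟩
  have h1 := hN n hn t ht'
  have h2 := hN N le_rfl t ht'
  rw [← dist_eq_norm] at h1 h2
  exact (dist_triangle_right _ _ _).trans_lt ((add_lt_add h1 h2).trans_eq (add_halves ε))

/-- Consistent nonexpansive schemes converge to the semigroup, uniformly on bounded time
intervals. -/
theorem tendstoUniformlyOn_iterate {S : ℝ → H → H} (hS : IsConsistent D g S) (η : H) (T : ℝ) :
    TendstoUniformlyOn (fun (n : ℕ) (t : ℝ) => (S (t / n))^[n] η)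
      (fun t => nlSemigroup D g t η) atTop (Ioo 0 T) := by
  rw [Metric.tendstoUniformlyOn_iff]
  intro ε hε
  obtain ⟨l, hl, h⟩ := hg.exists_step_eventually_forall_norm_sub_lt hD η T
    (show 0 < ε / 3 by positivity)
  filter_upwards [h S hS] with n hn t ht
  have h1 := hn t ht
  have h2 : ‖nlSemigroup D g t η - (nlResolvent D g l)^[⌊t / l⌋₊] η‖ ≤ ε / 3 := by
    refine le_of_tendsto ((hg.tendsto_nlSemigroup hD ht.1 η).sub_const _).norm ?_
    filter_upwards [h _ hg.isConsistent_nlResolvent] with m hm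
    exact (hm t ht).le
  rw [← dist_eq_norm] at h1 h2
  exact (dist_triangle_right _ _ _).trans_lt
    ((add_lt_add_of_le_of_lt h2 h1).trans (by linarith only [hε]))

end IsMaxDissipative

end Convergence

/-! ### Monotone operators and the Browder–Minty theorem -/

section Minty

/-- If `λᵀ M λ ≥ 0` for all `λ ≥ 0`, then `M ν ≥ 0` for some `ν` in the standard simplex: otherwise
a functional `λ ≥ 0` strictly separates the image of the simplex from the nonnegative orthant. -/
theorem exists_mem_stdSimplex_nonneg {ι : Type*} [Fintype ι] [Nonempty ι] (M : ι → ι → ℝ)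
    (hM : ∀ c : ι → ℝ, (∀ i, 0 ≤ c i) → 0 ≤ ∑ i, ∑ j, c i * c j * M i j) :
    ∃ ν ∈ stdSimplex ℝ ι, ∀ i, 0 ≤ ∑ j, ν j * M i j := by
  classical
  by_contra! hcon
  set L : (ι → ℝ) →ₗ[ℝ] (ι → ℝ) := Matrix.mulVecLin (Matrix.of M) with hL
  have hLapp : ∀ ν i, L ν i = ∑ j, ν j * M i j := fun ν i => by
    simp [hL, Matrix.mulVec, dotProduct, mul_comm]
  have hLc : Continuous L := L.continuous_of_finiteDimensional
  have hdisj : Disjoint (L '' stdSimplex ℝ ι) {y | ∀ i, 0 ≤ y i} := by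
    rw [Set.disjoint_left]
    rintro _ ⟨ν, hν, rfl⟩ h
    obtain ⟨i, hi⟩ := hcon ν hν
    have := h i
    rw [hLapp] at this
    linarith
  have hconv : Convex ℝ {y : ι → ℝ | ∀ i, 0 ≤ y i} := by
    intro x hx y hy a b ha hb _ i
    have := mul_nonneg ha (hx i)
    have := mul_nonneg hb (hy i)
    simp only [Pi.add_apply, Pi.smul_apply, smul_eq_mul]
    linarith
  have hclosed : IsClosed {y : ι → ℝ | ∀ i, 0 ≤ y i} := by
    simp only [ofPred_forall]
    exact isClosed_iInter fun i => isClosed_le continuous_const (continuous_apply i)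
  obtain ⟨φ, a, b, h1, hab, h2⟩ := geometric_hahn_banach_compact_closed
    ((convex_stdSimplex ℝ ι).linear_image L) ((isCompact_stdSimplex ℝ ι).image hLc) hconv
    hclosed hdisj
  have hb : b < 0 := by simpa using h2 0 (fun i => le_rfl)
  set c : ι → ℝ := fun i => φ (Pi.single i 1) with hc
  have hφ : ∀ y, φ y = ∑ i, y i * c i := fun y => by
    conv_lhs => rw [pi_eq_sum_univ' y]
    simp [hc, map_sum]
  have hc0 : ∀ i, 0 ≤ c i := by
    intro i
    by_contra! hi
    -- a negative `c i` would let `φ` reach the value `b` on the orthant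
    have := h2 ((b / c i) • Pi.single i 1) (fun j => by
      have h3 : 0 ≤ b / c i := (div_pos_of_neg_of_neg hb hi).le
      by_cases hj : j = i
      · subst hj; simpa using h3
      · simp [hj])
    rw [map_smul, smul_eq_mul] at this
    change b < b / c i * c i at this
    rw [div_mul_cancel₀ _ hi.ne] at this
    exact lt_irrefl _ this
  have hsum : 0 < ∑ i, c i := by
    refine lt_of_le_of_ne (Finset.sum_nonneg fun i _ => hc0 i) fun h0 => ?_
    have hz : ∀ i, c i = 0 := fun i =>
      (Finset.sum_eq_zero_iff_of_nonneg fun i _ => hc0 i).mp h0.symm i (Finset.mem_univ i)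
    obtain ⟨i⟩ := ‹Nonempty ι›
    have := h1 (L (Pi.single i 1)) ⟨_, single_mem_stdSimplex ℝ i, rfl⟩
    rw [hφ] at this
    simp only [hz, mul_zero, Finset.sum_const_zero] at this
    linarith
  set ν : ι → ℝ := fun i => (∑ i, c i)⁻¹ * c i with hν
  have hνmem : ν ∈ stdSimplex ℝ ι := by
    refine ⟨fun i => mul_nonneg (inv_nonneg.mpr hsum.le) (hc0 i), ?_⟩
    rw [← Finset.mul_sum, inv_mul_cancel₀ hsum.ne']
  have h3 := h1 (L ν) ⟨ν, hνmem, rfl⟩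
  have h4 : φ (L ν) = (∑ i, c i)⁻¹ * ∑ i, ∑ j, c i * c j * M i j := by
    rw [hφ, Finset.mul_sum]
    refine Finset.sum_congr rfl fun i _ => ?_
    rw [hLapp, Finset.sum_mul, Finset.mul_sum]
    refine Finset.sum_congr rfl fun j _ => ?_
    simp only [hν]; ring
  rw [h4] at h3
  have := mul_nonneg (inv_nonneg.mpr hsum.le) (hM c hc0)
  linarith

/-- The variational inequality for finitely many test points: a convex combination of them is a
solution, since the matrix `A_i (w_i - w_j)` is nonnegative on the orthant by monotonicity. -/
theorem exists_mem_forall_finset_nonneg {X : Type*} [AddCommGroup X] [Module ℝ X] {B : Set X}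
    (hB : Convex ℝ B) (hne : B.Nonempty) (A : X → X →ₗ[ℝ] ℝ)
    (hA : ∀ v ∈ B, ∀ w ∈ B, 0 ≤ (A v - A w) (v - w)) (s : Finset B) :
    ∃ u ∈ B, ∀ w ∈ s, A w u ≤ A w w := by
  rcases s.eq_empty_or_nonempty with rfl | hs
  · obtain ⟨u, hu⟩ := hne
    exact ⟨u, hu, by simp⟩
  have : Nonempty s := hs.to_subtype
  obtain ⟨ν, hν, h⟩ := exists_mem_stdSimplex_nonneg
    (fun i j : s => A i.1 (i.1.1 - j.1.1)) (fun c hc => by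
      have h1 : ∑ i : s, ∑ j : s, c i * c j * A i.1 (i.1.1 - j.1.1) =
          ∑ i : s, ∑ j : s, c i * c j * A j.1 (j.1.1 - i.1.1) := by
        rw [Finset.sum_comm]
        refine Finset.sum_congr rfl fun i _ => Finset.sum_congr rfl fun j _ => by ring
      have h2 : 0 ≤ ∑ i : s, ∑ j : s, (c i * c j * A i.1 (i.1.1 - j.1.1) +
          c i * c j * A j.1 (j.1.1 - i.1.1)) := by
        refine Finset.sum_nonneg fun i _ => Finset.sum_nonneg fun j _ => ?_
        have h3 := mul_nonneg (mul_nonneg (hc i) (hc j)) (hA i.1 i.1.2 j.1 j.1.2)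
        have h4 : (A i.1 - A j.1) (i.1.1 - j.1.1) =
            A i.1 (i.1.1 - j.1.1) + A j.1 (j.1.1 - i.1.1) := by
          rw [LinearMap.sub_apply, ← neg_sub i.1.1 j.1.1, map_neg]; ring
        rw [h4] at h3
        linarith
      simp only [Finset.sum_add_distrib] at h2
      linarith)
  refine ⟨∑ j : s, ν j • (j.1 : X), ?_, fun w hw => ?_⟩
  · exact hB.sum_mem (fun j _ => hν.1 j) hν.2 (fun j _ => j.1.2)
  · have h1 := h ⟨w, hw⟩
    have h2 : A w (∑ j : s, ν j • (j.1 : X)) = ∑ j : s, ν j * A w j.1 := by simp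
    have h3 : A w w = ∑ j : s, ν j * A w w := by rw [← Finset.sum_mul, hν.2, one_mul]
    rw [h2, h3, ← sub_nonneg, ← Finset.sum_sub_distrib]
    refine h1.trans_eq (Finset.sum_congr rfl fun j _ => ?_)
    rw [map_sub]; ring

/-- A family of closed convex sets with the finite intersection property has a common point, if it
lies in a set on which a midpoint uniformly convex functional `J` is bounded. This takes the place
of weak compactness: almost minimizers of `J` over the finite intersections form a Cauchy net. -/
theorem exists_forall_mem_of_uniformly_convex {X ι : Type*} [NormedAddCommGroup X]
    [NormedSpace ℝ X] [CompleteSpace X] (J : X → ℝ) (hJ0 : ∀ x, 0 ≤ J x) {R : ℝ}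
    (hJ : ∀ ε : ℝ, 0 < ε → ∃ κ : ℝ, 0 < κ ∧ ∀ x y, J x ≤ R → J y ≤ R →
      (J x + J y) / 2 - J ((1 / 2 : ℝ) • (x + y)) < κ → ‖x - y‖ < ε)
    (C : ι → Set X) (hconv : ∀ i, Convex ℝ (C i)) (hclosed : ∀ i, IsClosed (C i))
    (hfin : ∀ s : Finset ι, ∃ x, J x ≤ R ∧ ∀ i ∈ s, x ∈ C i) :
    ∃ x, ∀ i, x ∈ C i := by
  classical
  -- `m` is the supremum over `s` of the infima of `J` over the finite intersections `K s`
  set K : Finset ι → Set X := fun s => {x | J x ≤ R ∧ ∀ i ∈ s, x ∈ C i} with hK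
  set inf : Finset ι → ℝ := fun s => sInf (J '' K s) with hinf
  have hKanti : ∀ s t, s ⊆ t → K t ⊆ K s := fun s t hst x hx => ⟨hx.1, fun i hi => hx.2 i (hst hi)⟩
  have hKne : ∀ s, (J '' K s).Nonempty := fun s => by
    obtain ⟨x, hx⟩ := hfin s
    exact ⟨_, x, hx, rfl⟩
  have hbelow : ∀ s, BddBelow (J '' K s) := fun s => ⟨0, by rintro _ ⟨x, _, rfl⟩; exact hJ0 x⟩
  have hinfR : ∀ s, inf s ≤ R := fun s => by
    obtain ⟨_, x, hx, rfl⟩ := hKne s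
    exact (csInf_le (hbelow s) ⟨x, hx, rfl⟩).trans hx.1
  have hbdd : BddAbove (range inf) := ⟨R, by rintro _ ⟨s, rfl⟩; exact hinfR s⟩
  set m := ⨆ s, inf s with hm
  have hex : ∀ q : Finset ι × ℕ, ∃ x, x ∈ K q.1 ∧ J x < m + 1 / ((q.2 : ℝ) + 1) := fun q => by
    have h1 : inf q.1 < m + 1 / ((q.2 : ℝ) + 1) :=
      (le_ciSup hbdd q.1).trans_lt (lt_add_of_pos_right _ (by positivity))
    obtain ⟨_, ⟨x, hx, rfl⟩, hlt⟩ := exists_lt_of_csInf_lt (hKne q.1) h1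
    exact ⟨x, hx, hlt⟩
  choose x hxK hxJ using hex
  have hcauchy : CauchySeq x := by
    rw [Metric.cauchySeq_iff]
    intro ε hε
    obtain ⟨κ, hκ, h⟩ := hJ ε hε
    obtain ⟨s, hs⟩ := exists_lt_of_lt_ciSup (show m - κ / 2 < ⨆ s, inf s by rw [← hm]; linarith)
    obtain ⟨n, hn⟩ := exists_nat_one_div_lt (show 0 < κ / 2 by positivity)
    have hle : ∀ q : Finset ι × ℕ, (s, n) ≤ q → x q ∈ K s ∧ J (x q) < m + κ / 2 := fun q hq => by
      refine ⟨hKanti _ _ hq.1 (hxK q), (hxJ q).trans_le ?_⟩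
      have : 1 / ((q.2 : ℝ) + 1) ≤ 1 / ((n : ℝ) + 1) := by
        have : (n : ℝ) ≤ q.2 := by exact_mod_cast hq.2
        gcongr
      linarith
    refine ⟨(s, n), fun p hp q hq => ?_⟩
    obtain ⟨hp1, hp2⟩ := hle p hp
    obtain ⟨hq1, hq2⟩ := hle q hq
    rw [dist_eq_norm]
    refine h _ _ hp1.1 hq1.1 ?_
    have hmid : ∀ i ∈ s, (1 / 2 : ℝ) • (x p + x q) ∈ C i := fun i hi => by
      rw [smul_add]
      exact hconv i (hp1.2 i hi) (hq1.2 i hi) (by norm_num) (by norm_num) (by norm_num)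
    by_cases hR : J ((1 / 2 : ℝ) • (x p + x q)) ≤ R
    · have : inf s ≤ J ((1 / 2 : ℝ) • (x p + x q)) := csInf_le (hbelow s) ⟨_, ⟨hR, hmid⟩, rfl⟩
      linarith
    · have := hp1.1
      have := hq1.1
      linarith
  obtain ⟨z, hz⟩ := cauchySeq_tendsto_of_complete hcauchy
  refine ⟨z, fun i => (hclosed i).mem_of_tendsto hz ?_⟩
  filter_upwards [eventually_ge_atTop ({i}, 0)] with q hq
  exact (hxK q).2 i (hq.1 (Finset.mem_singleton_self i))

/-- The theorem of Browder and Minty for a hemicontinuous monotone operator `A`, on a Banach space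
with a uniformly convex functional `J` that measures coercivity. -/
theorem exists_apply_eq_zero_of_monotone {X : Type*} [NormedAddCommGroup X]
    [NormedSpace ℝ X] [CompleteSpace X] (J : X → ℝ) (hJ0 : ∀ x, 0 ≤ J x) (hJzero : J 0 = 0)
    (hJc : Continuous J) (hJconv : ConvexOn ℝ univ J)
    (hJ : ∀ R ε : ℝ, 0 < ε → ∃ κ : ℝ, 0 < κ ∧ ∀ x y, J x ≤ R → J y ≤ R →
      (J x + J y) / 2 - J ((1 / 2 : ℝ) • (x + y)) < κ → ‖x - y‖ < ε)
    (A : X → StrongDual ℝ X) (hmono : ∀ v w, 0 ≤ (A v - A w) (v - w))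
    (hhemi : ∀ u v, Tendsto (fun t : ℝ => A (u + t • v) v) (𝓝[>] 0) (𝓝 (A u v)))
    {R : ℝ} (hcoer : ∀ u, R ≤ J u → 0 < A u u) :
    ∃ u, ∀ v, A u v = 0 := by
  have hR : 0 < R := by
    by_contra! h
    have := hcoer 0 (h.trans (hJ0 0))
    simp at this
  set B : Set X := {x | J x ≤ R} with hBdef
  have hBconv : Convex ℝ B := by simpa [hBdef] using hJconv.convex_le R
  have hBclosed : IsClosed B := isClosed_le hJc continuous_const
  have h0B : (0 : X) ∈ B := by rw [hBdef, mem_ofPred_eq, hJzero]; exact hR.le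
  obtain ⟨u, hu⟩ := exists_forall_mem_of_uniformly_convex J hJ0 (hJ R)
    (fun w : B => B ∩ {u | A w u ≤ A w w})
    (fun w => hBconv.inter (convex_halfSpace_le (A w).isLinear _))
    (fun w => hBclosed.inter (isClosed_le (A w).continuous continuous_const))
    (fun s => by
      obtain ⟨u, hu, h⟩ := exists_mem_forall_finset_nonneg hBconv ⟨0, h0B⟩
        (fun w => (A w : X →ₗ[ℝ] ℝ)) (fun v _ w _ => by simpa using hmono v w) s
      exact ⟨u, hu, fun w hw => ⟨hu, h w hw⟩⟩)
  have huB : u ∈ B := (hu ⟨0, h0B⟩).1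
  -- Minty's trick: test with points of the segment from `u` to `w`
  have hvar : ∀ w ∈ B, 0 ≤ A u (w - u) := fun w hw => by
    refine ge_of_tendsto (hhemi u (w - u)) ?_
    filter_upwards [Ioo_mem_nhdsGT (show (0 : ℝ) < 1 by norm_num)] with t ht
    have hmem : u + t • (w - u) ∈ B := by
      have := hBconv huB hw (sub_nonneg.mpr ht.2.le) ht.1.le (sub_add_cancel 1 t)
      rwa [show (1 - t) • u + t • w = u + t • (w - u) by module] at this
    have h1 : A (u + t • (w - u)) u ≤ A (u + t • (w - u)) (u + t • (w - u)) := (hu ⟨_, hmem⟩).2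
    rw [map_add, map_smul, smul_eq_mul] at h1
    exact nonneg_of_mul_nonneg_right (by linarith) ht.1
  have hlt : J u < R := by
    by_contra! h
    have h1 := hcoer u h
    have h2 := hvar 0 h0B
    rw [zero_sub, map_neg] at h2
    linarith
  have hnonneg : ∀ v, 0 ≤ A u v := fun v => by
    have hc : Tendsto (fun t : ℝ => J (u + t • v)) (𝓝[>] 0) (𝓝 (J u)) := by
      have : Continuous fun t : ℝ => J (u + t • v) := by fun_prop
      simpa using (this.tendsto 0).mono_left nhdsWithin_le_nhds
    obtain ⟨t, ht, ht0⟩ := ((hc.eventually_lt_const hlt).and eventually_mem_nhdsWithin).exists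
    have := hvar _ (show u + t • v ∈ B from ht.le)
    rw [add_sub_cancel_left, map_smul, smul_eq_mul] at this
    exact nonneg_of_mul_nonneg_right this ht0
  refine ⟨u, fun v => le_antisymm ?_ (hnonneg v)⟩
  have := hnonneg (-v)
  rw [map_neg] at this
  linarith

end Minty

/-! ### Uniform convexity of `L^p` and superposition operators -/

section LpNorm

variable {E : Type*} [NormedAddCommGroup E]
variable {Ω : Type*} [MeasurableSpace Ω] {μ : Measure Ω} {p : ℝ}

theorem Lp_norm_rpow_eq_integral (hp : 1 < p) (f : Lp E (ENNReal.ofReal p) μ) :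
    ‖f‖ ^ p = ∫ x, ‖f x‖ ^ p ∂μ := by
  have hp0 : 0 < p := by linarith
  have h0 : ENNReal.ofReal p ≠ 0 := by simpa using hp0
  rw [Lp.norm_def, (Lp.memLp f).eLpNorm_eq_integral_rpow_norm h0 ENNReal.ofReal_ne_top,
    ENNReal.toReal_ofReal hp0.le, ENNReal.toReal_ofReal (by positivity), ← Real.rpow_mul
    (by positivity), inv_mul_cancel₀ hp0.ne', Real.rpow_one]

theorem Lp_integrable_norm_rpow (hp : 1 < p) (f : Lp E (ENNReal.ofReal p) μ) :
    Integrable (fun x => ‖f x‖ ^ p) μ := by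
  have hp0 : 0 < p := by linarith
  have := (Lp.memLp f).integrable_norm_rpow (by simpa using hp0) ENNReal.ofReal_ne_top
  rwa [ENNReal.toReal_ofReal hp0.le] at this

variable {H : Type*} [NormedAddCommGroup H] [Fact (1 ≤ ENNReal.ofReal p)]

/-- The functional `‖u‖² + ‖g‖_p^p` on `H × L^p`. -/
noncomputable def sqAddRpow (p : ℝ) (q : H × Lp E (ENNReal.ofReal p) μ) : ℝ := ‖q.1‖ ^ 2 + ‖q.2‖ ^ p

theorem sqAddRpow_nonneg (q : H × Lp E (ENNReal.ofReal p) μ) : 0 ≤ sqAddRpow p q := by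
  rw [sqAddRpow]; positivity

theorem continuous_sqAddRpow (hp : 1 < p) :
    Continuous (sqAddRpow p : H × Lp E (ENNReal.ofReal p) μ → ℝ) :=
  (continuous_fst.norm.pow 2).add (continuous_snd.norm.rpow_const fun _ => Or.inr (by linarith))

end LpNorm

section UniformConvexity

variable {E : Type*} [NormedAddCommGroup E] [NormedSpace ℝ E]

theorem norm_half_add_rpow_le {p : ℝ} (hp : 1 < p) (a b : E) :
    ‖(1 / 2 : ℝ) • (a + b)‖ ^ p ≤ (‖a‖ ^ p + ‖b‖ ^ p) / 2 := by
  have h1 : ‖(1 / 2 : ℝ) • (a + b)‖ ≤ (1 / 2 : ℝ) * ‖a‖ + (1 / 2 : ℝ) * ‖b‖ := by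
    rw [norm_smul, Real.norm_of_nonneg (by norm_num)]
    linarith [norm_add_le a b]
  calc ‖(1 / 2 : ℝ) • (a + b)‖ ^ p ≤ ((1 / 2 : ℝ) * ‖a‖ + (1 / 2 : ℝ) * ‖b‖) ^ p := by gcongr
    _ ≤ (1 / 2 : ℝ) * ‖a‖ ^ p + (1 / 2 : ℝ) * ‖b‖ ^ p :=
        (strictConvexOn_rpow hp).convexOn.2 (norm_nonneg a) (norm_nonneg b) (by norm_num)
          (by norm_num) (by norm_num)
    _ = _ := by ring

theorem norm_half_add_rpow_lt [StrictConvexSpace ℝ E] {p : ℝ} (hp : 1 < p) {a b : E}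
    (hab : a ≠ b) : ‖(1 / 2 : ℝ) • (a + b)‖ ^ p < (‖a‖ ^ p + ‖b‖ ^ p) / 2 := by
  have e : ‖(1 / 2 : ℝ) • (a + b)‖ = (1 / 2 : ℝ) * ‖a + b‖ := by
    rw [norm_smul, Real.norm_of_nonneg (by norm_num)]
  rw [e]
  have h1 := (strictConvexOn_rpow hp).convexOn.2 (norm_nonneg a) (norm_nonneg b)
    (show (0 : ℝ) ≤ 1 / 2 by norm_num) (show (0 : ℝ) ≤ 1 / 2 by norm_num) (by norm_num)
  simp only [smul_eq_mul] at h1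
  by_cases hn : ‖a‖ = ‖b‖
  · have h2 : ‖a + b‖ < ‖a‖ + ‖b‖ :=
      lt_of_le_of_ne (norm_add_le a b) fun h => hab (eq_of_norm_eq_of_norm_add_eq hn h)
    have h3 : (1 / 2 * ‖a + b‖) ^ p < (1 / 2 * ‖a‖ + 1 / 2 * ‖b‖) ^ p :=
      Real.rpow_lt_rpow (by positivity) (by linarith) (by linarith)
    linarith
  · have h2 := (strictConvexOn_rpow hp).2 (norm_nonneg a) (norm_nonneg b) hn
      (show (0 : ℝ) < 1 / 2 by norm_num) (show (0 : ℝ) < 1 / 2 by norm_num) (by norm_num)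
    simp only [smul_eq_mul] at h2
    have h3 : (1 / 2 * ‖a + b‖) ^ p ≤ (1 / 2 * ‖a‖ + 1 / 2 * ‖b‖) ^ p := by
      gcongr
      linarith [norm_add_le a b]
    linarith

/-- A quantitative form of the strict convexity of `‖·‖ ^ p`. By homogeneity it suffices to consider
the compact set where `‖a‖ ^ p + ‖b‖ ^ p = 1`, on which the convexity gap is bounded below as long
as `‖a - b‖ ^ p ≥ ε`. -/
theorem exists_norm_sub_rpow_le [StrictConvexSpace ℝ E] [ProperSpace E] {p : ℝ} (hp : 1 < p)
    {ε : ℝ} (hε : 0 < ε) :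
    ∃ C : ℝ, 0 < C ∧ ∀ a b : E, ‖a - b‖ ^ p ≤ ε * (‖a‖ ^ p + ‖b‖ ^ p) +
      C * ((‖a‖ ^ p + ‖b‖ ^ p) / 2 - ‖(1 / 2 : ℝ) • (a + b)‖ ^ p) := by
  have hp0 : 0 < p := by linarith
  set G : E × E → ℝ := fun q =>
    (‖q.1‖ ^ p + ‖q.2‖ ^ p) / 2 - ‖(1 / 2 : ℝ) • (q.1 + q.2)‖ ^ p with hG
  have hr : ∀ f : E × E → E, Continuous f → Continuous fun q => ‖f q‖ ^ p := fun f hf =>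
    hf.norm.rpow_const fun _ => Or.inr hp0.le
  have hGc : Continuous G :=
    (((hr _ continuous_fst).add (hr _ continuous_snd)).div_const 2).sub
      (hr _ ((continuous_fst.add continuous_snd).const_smul _))
  set K : Set (E × E) := {q | ‖q.1‖ ^ p + ‖q.2‖ ^ p = 1 ∧ ε ≤ ‖q.1 - q.2‖ ^ p} with hK
  have hball : ∀ a b : E, ‖a‖ ^ p + ‖b‖ ^ p = 1 → ‖a‖ ≤ 1 ∧ ‖b‖ ≤ 1 := fun a b h => by
    have h1 : 0 ≤ ‖a‖ ^ p := by positivity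
    have h2 : 0 ≤ ‖b‖ ^ p := by positivity
    refine ⟨le_of_not_gt fun h3 => ?_, le_of_not_gt fun h3 => ?_⟩ <;>
    · have := Real.one_lt_rpow h3 hp0
      linarith
  have hKc : IsCompact K := by
    refine Metric.isCompact_of_isClosed_isBounded ?_ ?_
    · exact (isClosed_eq ((hr _ continuous_fst).add (hr _ continuous_snd)) continuous_const).inter
        (isClosed_le continuous_const (hr _ (continuous_fst.sub continuous_snd)))
    · refine (Metric.isBounded_closedBall (x := (0 : E × E)) (r := 1)).subset fun q hq => ?_
      rw [mem_closedBall_zero_iff, Prod.norm_def]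
      exact max_le (hball _ _ hq.1).1 (hball _ _ hq.1).2
  obtain ⟨c, hc, hcK⟩ : ∃ c : ℝ, 0 < c ∧ ∀ q ∈ K, c ≤ G q := by
    rcases K.eq_empty_or_nonempty with h0 | hne
    · exact ⟨1, one_pos, fun q hq => by simp [h0] at hq⟩
    · obtain ⟨q, hq, hmin⟩ := hKc.exists_isMinOn hne hGc.continuousOn
      refine ⟨G q, ?_, fun r hr => hmin hr⟩
      have hne : q.1 ≠ q.2 := fun h => by
        have := hq.2
        rw [h, sub_self, norm_zero, Real.zero_rpow hp0.ne'] at this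
        linarith
      exact sub_pos.mpr (norm_half_add_rpow_lt hp hne)
  refine ⟨2 ^ p / c, by positivity, fun a b => ?_⟩
  by_cases h0 : ‖a‖ ^ p + ‖b‖ ^ p = 0
  · have h1 : 0 ≤ ‖a‖ ^ p := by positivity
    have h2 : 0 ≤ ‖b‖ ^ p := by positivity
    have ha : ‖a‖ = 0 := (Real.rpow_eq_zero (norm_nonneg _) hp0.ne').mp (by linarith)
    have hb : ‖b‖ = 0 := (Real.rpow_eq_zero (norm_nonneg _) hp0.ne').mp (by linarith)
    rw [norm_eq_zero] at ha hb
    simp [ha, hb, Real.zero_rpow hp0.ne']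
  set s := ‖a‖ ^ p + ‖b‖ ^ p with hs
  have hs0 : 0 < s := lt_of_le_of_ne (by positivity) (Ne.symm h0)
  set r := s ^ (-p⁻¹) with hrdef
  have hr0 : 0 < r := by positivity
  have hrp : r ^ p = s⁻¹ := by
    rw [hrdef, ← Real.rpow_mul hs0.le, neg_mul, inv_mul_cancel₀ hp0.ne', Real.rpow_neg_one]
  have hscale : ∀ x : E, ‖r • x‖ ^ p = s⁻¹ * ‖x‖ ^ p := fun x => by
    rw [norm_smul, Real.norm_of_nonneg hr0.le, Real.mul_rpow hr0.le (norm_nonneg _), hrp]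
  have hone : ‖r • a‖ ^ p + ‖r • b‖ ^ p = 1 := by
    rw [hscale, hscale, ← mul_add, ← hs, inv_mul_cancel₀ h0]
  have hGs : G (r • a, r • b) = s⁻¹ * G (a, b) := by
    simp only [hG]
    rw [← smul_add, smul_comm, hscale, hscale, hscale]; ring
  have hG0 : 0 ≤ G (a, b) := sub_nonneg.mpr (norm_half_add_rpow_le hp a b)
  have key : ‖r • a - r • b‖ ^ p ≤ ε + 2 ^ p / c * G (r • a, r • b) := by
    by_cases hle : ε ≤ ‖r • a - r • b‖ ^ p
    · have h1 := hcK (r • a, r • b) ⟨hone, hle⟩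
      have h2 : ‖r • a - r • b‖ ^ p ≤ 2 ^ p := by
        gcongr
        linarith [norm_sub_le (r • a) (r • b), (hball _ _ hone).1, (hball _ _ hone).2]
      have h3 : (2 : ℝ) ^ p ≤ 2 ^ p / c * G (r • a, r • b) := by
        rw [div_mul_eq_mul_div, le_div_iff₀ hc]
        gcongr
      linarith
    · have : 0 ≤ 2 ^ p / c * G (r • a, r • b) := by rw [hGs]; positivity
      linarith
  rw [← smul_sub, hscale, hGs] at key
  have := mul_le_mul_of_nonneg_left key hs0.le
  rw [← mul_assoc, mul_inv_cancel₀ h0, one_mul] at this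
  refine this.trans (le_of_eq ?_)
  change s * (ε + 2 ^ p / c * (s⁻¹ * G (a, b))) = ε * s + 2 ^ p / c * G (a, b)
  field_simp

variable {Ω : Type*} [MeasurableSpace Ω] {μ : Measure Ω} {p : ℝ}

theorem Lp_exists_norm_sub_rpow_le [StrictConvexSpace ℝ E] [ProperSpace E] (hp : 1 < p)
    {ε : ℝ} (hε : 0 < ε) :
    ∃ C : ℝ, 0 < C ∧ ∀ f g : Lp E (ENNReal.ofReal p) μ, ‖f - g‖ ^ p ≤ ε * (‖f‖ ^ p + ‖g‖ ^ p) +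
      C * ((‖f‖ ^ p + ‖g‖ ^ p) / 2 - ‖(1 / 2 : ℝ) • (f + g)‖ ^ p) := by
  obtain ⟨C, hC, h⟩ := exists_norm_sub_rpow_le (E := E) hp hε
  refine ⟨C, hC, fun f g => ?_⟩
  have i1 := Lp_integrable_norm_rpow hp f
  have i2 := Lp_integrable_norm_rpow hp g
  have i3 := Lp_integrable_norm_rpow hp (f - g)
  have i4 := Lp_integrable_norm_rpow hp ((1 / 2 : ℝ) • (f + g))
  simp only [Lp_norm_rpow_eq_integral hp]
  have j1 : Integrable (fun x => ε * (‖f x‖ ^ p + ‖g x‖ ^ p)) μ := (i1.add i2).const_mul ε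
  have j2 : Integrable (fun x => (‖f x‖ ^ p + ‖g x‖ ^ p) / 2) μ := (i1.add i2).div_const 2
  have j3 : Integrable (fun x => C * ((‖f x‖ ^ p + ‖g x‖ ^ p) / 2 -
      ‖((1 / 2 : ℝ) • (f + g) : Lp E (ENNReal.ofReal p) μ) x‖ ^ p)) μ := (j2.sub i4).const_mul C
  rw [← integral_add i1 i2, ← integral_const_mul, ← integral_div, ← integral_sub j2 i4,
    ← integral_const_mul, ← integral_add j1 j3]
  refine integral_mono_ae i3 (j1.add j3) ?_
  filter_upwards [Lp.coeFn_sub f g, Lp.coeFn_smul (1 / 2 : ℝ) (f + g), Lp.coeFn_add f g]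
    with x h1 h2 h3
  simp only [h1, h2, Pi.sub_apply, Pi.smul_apply, h3, Pi.add_apply]
  exact h _ _

variable {H : Type*} [NormedAddCommGroup H] [InnerProductSpace ℝ H] [Fact (1 ≤ ENNReal.ofReal p)]

theorem convexOn_sqAddRpow (hp : 1 < p) :
    ConvexOn ℝ univ (sqAddRpow p : H × Lp E (ENNReal.ofReal p) μ → ℝ) := by
  refine ⟨convex_univ, fun x _ y _ a b ha hb hab => ?_⟩
  have h1 : ‖a • x.1 + b • y.1‖ ^ 2 ≤ a * ‖x.1‖ ^ 2 + b * ‖y.1‖ ^ 2 :=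
    calc ‖a • x.1 + b • y.1‖ ^ 2 ≤ (a * ‖x.1‖ + b * ‖y.1‖) ^ 2 := by
          gcongr
          refine (norm_add_le _ _).trans_eq ?_
          rw [norm_smul, norm_smul, Real.norm_of_nonneg ha, Real.norm_of_nonneg hb]
      _ ≤ _ := (convexOn_pow 2).2 (norm_nonneg x.1) (norm_nonneg y.1) ha hb hab
  have h2 : ‖a • x.2 + b • y.2‖ ^ p ≤ a * ‖x.2‖ ^ p + b * ‖y.2‖ ^ p :=
    calc ‖a • x.2 + b • y.2‖ ^ p ≤ (a * ‖x.2‖ + b * ‖y.2‖) ^ p := by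
          gcongr
          refine (norm_add_le _ _).trans_eq ?_
          rw [norm_smul, norm_smul, Real.norm_of_nonneg ha, Real.norm_of_nonneg hb]
      _ ≤ _ := (strictConvexOn_rpow hp).convexOn.2 (norm_nonneg x.2) (norm_nonneg y.2) ha hb hab
  simp only [sqAddRpow, Prod.fst_add, Prod.smul_fst, Prod.snd_add, Prod.smul_snd, smul_eq_mul]
  linarith

theorem sqAddRpow_uniformly_convex [StrictConvexSpace ℝ E] [ProperSpace E]
    (hp : 1 < p) (R ε : ℝ)
    (hε : 0 < ε) : ∃ κ : ℝ, 0 < κ ∧ ∀ x y : H × Lp E (ENNReal.ofReal p) μ,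
      sqAddRpow p x ≤ R → sqAddRpow p y ≤ R →
      (sqAddRpow p x + sqAddRpow p y) / 2 - sqAddRpow p ((1 / 2 : ℝ) • (x + y)) < κ →
      ‖x - y‖ < ε := by
  have hp0 : 0 < p := by linarith
  have hεp : 0 < ε ^ p := by positivity
  obtain ⟨C, hC, h⟩ := Lp_exists_norm_sub_rpow_le (E := E) (μ := μ) hp
    (show 0 < ε ^ p / (4 * (|R| + 1)) by positivity)
  refine ⟨min (ε ^ 2 / 4) (ε ^ p / (2 * C)), by positivity, fun x y hx hy hgap => ?_⟩
  have hgap1 := hgap.trans_le (min_le_left _ _)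
  have hgap2 := hgap.trans_le (min_le_right _ _)
  simp only [sqAddRpow, Prod.fst_add, Prod.smul_fst, Prod.snd_add, Prod.smul_snd]
    at hx hy hgap1 hgap2
  have hpar : (‖x.1‖ ^ 2 + ‖y.1‖ ^ 2) / 2 - ‖(1 / 2 : ℝ) • (x.1 + y.1)‖ ^ 2 =
      ‖x.1 - y.1‖ ^ 2 / 4 := by
    rw [norm_smul, mul_pow, norm_add_sq_real, norm_sub_sq_real, Real.norm_of_nonneg (by norm_num)]
    ring
  have hmid : 0 ≤ (‖x.2‖ ^ p + ‖y.2‖ ^ p) / 2 - ‖(1 / 2 : ℝ) • (x.2 + y.2)‖ ^ p :=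
    sub_nonneg.mpr (norm_half_add_rpow_le hp _ _)
  have hsq : 0 ≤ ‖x.1 - y.1‖ ^ 2 := by positivity
  rw [Prod.norm_def]
  refine max_lt ?_ ?_
  · refine lt_of_pow_lt_pow_left₀ 2 hε.le ?_
    simp only [Prod.fst_sub]
    linarith
  · have h1 := h x.2 y.2
    set G := (‖x.2‖ ^ p + ‖y.2‖ ^ p) / 2 - ‖(1 / 2 : ℝ) • (x.2 + y.2)‖ ^ p with hG
    have h2 : C * G < ε ^ p / 2 := by
      have : G < ε ^ p / (2 * C) := by linarith
      rw [lt_div_iff₀ (by positivity)] at this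
      linarith
    have h3 : ε ^ p / (4 * (|R| + 1)) * (‖x.2‖ ^ p + ‖y.2‖ ^ p) ≤ ε ^ p / 2 := by
      have h4 : ‖x.2‖ ^ p + ‖y.2‖ ^ p ≤ 2 * (|R| + 1) := by
        have := le_abs_self R
        have : 0 ≤ ‖x.1‖ ^ 2 := by positivity
        have : 0 ≤ ‖y.1‖ ^ 2 := by positivity
        linarith
      calc _ ≤ ε ^ p / (4 * (|R| + 1)) * (2 * (|R| + 1)) := by gcongr
        _ = ε ^ p / 2 := by field_simp; ring
    refine lt_of_not_ge fun hge => ?_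
    have h5 : ε ^ p ≤ ‖x.2 - y.2‖ ^ p := Real.rpow_le_rpow hε.le hge hp0.le
    linarith

end UniformConvexity

section Caratheodory

variable {X E F : Type*} [MeasurableSpace X] {μ : Measure X} [NormedAddCommGroup E]
  [NormedAddCommGroup F]

/-- The superposition of a Carathéodory function and a measurable function is measurable. -/
theorem aestronglyMeasurable_superposition {α : X → E → F}
    (hc : ∀ᵐ x ∂μ, Continuous (α x)) (hm : ∀ z, AEStronglyMeasurable (fun x => α x z) μ)
    {v : X → E} (hv : AEStronglyMeasurable v μ) :
    AEStronglyMeasurable (fun x => α x (v x)) μ := by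
  have hsimple : ∀ s : SimpleFunc X E, AEStronglyMeasurable (fun x => α x (s x)) μ := fun s => by
    have e : (fun x => α x (s x)) =
        ∑ z ∈ s.range, (s ⁻¹' {z}).indicator (fun x => α x z) := by
      ext x
      rw [Finset.sum_apply, Finset.sum_eq_single (s x)]
      · simp
      · intro z _ hz
        exact indicator_of_notMem (by simpa using hz.symm) _
      · intro h
        exact absurd (SimpleFunc.mem_range_self s x) h
    rw [e]
    exact Finset.aestronglyMeasurable_sum _ fun z _ =>
      (hm z).indicator (s.measurableSet_fiber z)
  refine aestronglyMeasurable_of_tendsto_ae atTop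
    (fun n => hsimple (hv.stronglyMeasurable_mk.approx n)) ?_
  filter_upwards [hc, hv.ae_eq_mk] with x hx hvx
  rw [hvx]
  exact (hx.tendsto _).comp (hv.stronglyMeasurable_mk.tendsto_approx x)

end Caratheodory

/-! ### Friedrich extensions and the energetic form -/

section Friedrich

variable {H : Type*} [NormedAddCommGroup H] [InnerProductSpace ℝ H]

theorem mem_friedrichDomain_of_inner {V : Set H} {F : H → H → ℝ} {u w : H} (hu : u ∈ V)
    (h : ∀ v ∈ V, ⟪w, v⟫_ℝ = F u v) : u ∈ friedrichDomain V F :=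
  ⟨hu, innerSL ℝ w, h⟩

variable [CompleteSpace H]

theorem inner_friedrich {V : Set H} {F : H → H → ℝ} {u v : H} (hu : u ∈ friedrichDomain V F)
    (hv : v ∈ V) : ⟪friedrich V F u, v⟫_ℝ = -F u v := by
  have h : u ∈ V ∧ ∃ ψ : StrongDual ℝ H, ∀ v ∈ V, ψ v = F u v := hu
  rw [friedrich, dif_pos h, inner_neg_left, InnerProductSpace.toDual_symm_apply,
    h.2.choose_spec v hv]

theorem friedrich_eq_neg {V : Set H} (hV : Dense V) {F : H → H → ℝ} {u w : H} (hu : u ∈ V)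
    (h : ∀ v ∈ V, ⟪w, v⟫_ℝ = F u v) : friedrich V F u = -w := by
  refine hV.eq_of_inner_left (𝕜 := ℝ) fun v hv => ?_
  rw [inner_friedrich (mem_friedrichDomain_of_inner hu h) hv, inner_neg_left, h v hv]

/-- The Friedrich extension of a monotone form is maximal dissipative, if `u + h F u = y` is
solvable in the weak sense. -/
theorem isMaxDissipative_friedrich {V : Set H} (hV : Dense V) {F : H → H → ℝ}
    (hsub : ∀ u ∈ V, ∀ v ∈ V, u - v ∈ V)
    (hmono : ∀ u ∈ V, ∀ v ∈ V, 0 ≤ F u (u - v) - F v (u - v))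
    (hsolve : ∀ h : ℝ, 0 < h → ∀ y : H, ∃ u ∈ V, ∀ v ∈ V, ⟪u - y, v⟫_ℝ + h * F u v = 0) :
    IsMaxDissipative (friedrichDomain V F) (friedrich V F) where
  dissipative u hu v hv := by
    have huv := hsub u hu.1 v hv.1
    rw [inner_sub_left, inner_friedrich hu huv, inner_friedrich hv huv]
    linarith [hmono u hu.1 v hv.1]
  surjective h hh y := by
    obtain ⟨u, hu, huv⟩ := hsolve h hh y
    have hw : ∀ v ∈ V, ⟪-(h⁻¹ • (u - y)), v⟫_ℝ = F u v := fun v hv => by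
      have := huv v hv
      rw [inner_neg_left, real_inner_smul_left]
      field_simp
      linarith
    refine ⟨u, mem_friedrichDomain_of_inner hu hw, ?_⟩
    rw [friedrich_eq_neg hV hu hw, neg_neg, smul_inv_smul₀ hh.ne', sub_sub_cancel]

end Friedrich

section Energy

variable {d k : ℕ} {Ω : Opens (EuclideanSpace ℝ (Fin d))} {p : ℝ}
  {α : EuclideanSpace ℝ (Fin d) → EuclideanSpace ℝ (Fin k) → EuclideanSpace ℝ (Fin k)}
  {μ : Measure (EuclideanSpace ℝ (Fin d))}

theorem fact_one_le_ofReal (hp : 1 < p) : Fact (1 ≤ ENNReal.ofReal p) :=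
  ⟨by rw [ENNReal.one_le_ofReal]; exact hp.le⟩

theorem one_lt_conj (hp : 1 < p) : 1 < p / (p - 1) := by
  rw [one_lt_div (by linarith)]; linarith

theorem holderConjugate_ofReal (hp : 1 < p) :
    (ENNReal.ofReal (p / (p - 1))).HolderConjugate (ENNReal.ofReal p) :=
  (Real.HolderConjugate.conjExponent hp).symm.ennrealOfReal

theorem integrable_inner_of_memLp (hp : 1 < p)
    {f g : EuclideanSpace ℝ (Fin d) → EuclideanSpace ℝ (Fin k)}
    (hf : MemLp f (ENNReal.ofReal (p / (p - 1))) μ) (hg : MemLp g (ENNReal.ofReal p) μ) :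
    Integrable (fun x => ⟪f x, g x⟫_ℝ) μ := by
  have := holderConjugate_ofReal hp
  exact memLp_one_iff_integrable.mp
    ((innerSL ℝ : EuclideanSpace ℝ (Fin k) →L[ℝ] _ →L[ℝ] ℝ).memLp_of_bilin 1 hf hg)

/-- The functional `g ↦ ∫ ⟪f, g⟫` on `L^p` defined by a function `f` in the dual Lebesgue space. -/
theorem exists_dual_eq_integral (hp : 1 < p) [Fact (1 ≤ ENNReal.ofReal p)]
    {f : EuclideanSpace ℝ (Fin d) → EuclideanSpace ℝ (Fin k)}
    (hf : MemLp f (ENNReal.ofReal (p / (p - 1))) μ) :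
    ∃ ψ : StrongDual ℝ (Lp (EuclideanSpace ℝ (Fin k)) (ENNReal.ofReal p) μ),
      ∀ g, ψ g = ∫ x, ⟪f x, g x⟫_ℝ ∂μ := by
  have := holderConjugate_ofReal hp
  have := fact_one_le_ofReal (one_lt_conj hp)
  refine ⟨(innerSL ℝ : EuclideanSpace ℝ (Fin k) →L[ℝ] _ →L[ℝ] ℝ).lpPairing μ _ _ hf.toLp,
    fun g => ?_⟩
  rw [ContinuousLinearMap.lpPairing_eq_integral]
  refine integral_congr_ae ?_
  filter_upwards [hf.coeFn_toLp] with x hx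
  rw [hx]; rfl

namespace IsEnergyMap

variable (hα : IsEnergyMap Ω p α) (hμ : μ ≤ volume.restrict Ω)
include hα hμ

theorem aestronglyMeasurable {v : EuclideanSpace ℝ (Fin d) → EuclideanSpace ℝ (Fin k)}
    (hv : AEStronglyMeasurable v μ) : AEStronglyMeasurable (fun x => α x (v x)) μ :=
  aestronglyMeasurable_superposition (ae_mono hμ hα.continuous)
    (fun z => (hα.measurable z).aestronglyMeasurable.mono_measure hμ) hv

/-- If `|v| ≤ w ∈ L^p`, then `α(·, v)` is bounded by a function in the dual Lebesgue space that
depends on `w` only. -/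
theorem exists_bound (hp : 1 < p) {w : EuclideanSpace ℝ (Fin d) → ℝ}
    (hw : MemLp w (ENNReal.ofReal p) μ) :
    ∃ b : EuclideanSpace ℝ (Fin d) → ℝ, MemLp b (ENNReal.ofReal (p / (p - 1))) μ ∧
      ∀ᵐ x ∂μ, ∀ z, ‖z‖ ≤ w x → ‖α x z‖ ≤ b x := by
  obtain ⟨c₁, c₂, hc₁, hc₂, -, hgrowth⟩ := hα.growth
  refine ⟨fun x => c₁ * ‖w x‖ ^ (p - 1) + c₂ x, ?_, ?_⟩
  · have h1 := hw.norm_rpow_div (ENNReal.ofReal (p - 1))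
    rw [ENNReal.toReal_ofReal (by linarith), ← ENNReal.ofReal_div_of_pos (by linarith)] at h1
    exact (h1.const_mul c₁).add (hc₂.mono_measure hμ)
  · filter_upwards [ae_mono hμ hgrowth] with x hx z hz
    refine (hx z).trans ?_
    have : 0 ≤ p - 1 := by linarith
    have : ‖z‖ ≤ ‖w x‖ := hz.trans (Real.le_norm_self _)
    gcongr

theorem memLp (hp : 1 < p) {v : EuclideanSpace ℝ (Fin d) → EuclideanSpace ℝ (Fin k)}
    (hv : MemLp v (ENNReal.ofReal p) μ) :
    MemLp (fun x => α x (v x)) (ENNReal.ofReal (p / (p - 1))) μ := by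
  obtain ⟨b, hb, h⟩ := hα.exists_bound hμ hp hv.norm
  refine hb.mono' (hα.aestronglyMeasurable hμ hv.1) ?_
  filter_upwards [h] with x hx
  exact hx _ le_rfl

theorem integrable_inner (hp : 1 < p) {v w : EuclideanSpace ℝ (Fin d) → EuclideanSpace ℝ (Fin k)}
    (hv : MemLp v (ENNReal.ofReal p) μ) (hw : MemLp w (ENNReal.ofReal p) μ) :
    Integrable (fun x => ⟪α x (v x), w x⟫_ℝ) μ :=
  integrable_inner_of_memLp hp (hα.memLp hμ hp hv) hw

theorem integral_monotone (hp : 1 < p) {v w : EuclideanSpace ℝ (Fin d) → EuclideanSpace ℝ (Fin k)}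
    (hv : MemLp v (ENNReal.ofReal p) μ) (hw : MemLp w (ENNReal.ofReal p) μ) :
    0 ≤ ∫ x, ⟪α x (v x), v x - w x⟫_ℝ ∂μ - ∫ x, ⟪α x (w x), v x - w x⟫_ℝ ∂μ := by
  have i1 : Integrable (fun x => ⟪α x (v x), v x - w x⟫_ℝ) μ :=
    hα.integrable_inner hμ hp hv (hv.sub hw)
  have i2 : Integrable (fun x => ⟪α x (w x), v x - w x⟫_ℝ) μ :=
    hα.integrable_inner hμ hp hw (hv.sub hw)
  rw [← integral_sub i1 i2]
  refine integral_nonneg_of_ae ?_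
  filter_upwards [ae_mono hμ hα.monotone] with x hx
  rw [← inner_sub_left]
  exact hx _ _

/-- Hemicontinuity of the energetic operator. -/
theorem tendsto_integral (hp : 1 < p) {v w : EuclideanSpace ℝ (Fin d) → EuclideanSpace ℝ (Fin k)}
    (hv : MemLp v (ENNReal.ofReal p) μ) (hw : MemLp w (ENNReal.ofReal p) μ) :
    Tendsto (fun t : ℝ => ∫ x, ⟪α x (v x + t • w x), w x⟫_ℝ ∂μ) (𝓝[>] 0)
      (𝓝 (∫ x, ⟪α x (v x), w x⟫_ℝ ∂μ)) := by
  obtain ⟨b, hb, h⟩ := hα.exists_bound hμ hp (hv.norm.add hw.norm)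
  have hconj := holderConjugate_ofReal hp
  refine tendsto_integral_filter_of_dominated_convergence (fun x => b x * ‖w x‖) ?_ ?_
    (hb.integrable_mul hw.norm) ?_
  · refine Eventually.of_forall fun t => ?_
    exact (hα.integrable_inner hμ hp (hv.add (hw.const_smul t)) hw).1
  · filter_upwards [Ioo_mem_nhdsGT (show (0 : ℝ) < 1 by norm_num)] with t ht
    filter_upwards [h] with x hx
    refine (norm_inner_le_norm _ _).trans ?_
    gcongr
    refine hx _ ((norm_add_le _ _).trans ?_)
    simp only [Pi.add_apply]
    gcongr
    rw [norm_smul, Real.norm_of_nonneg ht.1.le]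
    exact mul_le_of_le_one_left (norm_nonneg _) ht.2.le
  · filter_upwards [ae_mono hμ hα.continuous] with x hx
    have : Continuous fun t : ℝ => ⟪α x (v x + t • w x), w x⟫_ℝ := by fun_prop
    simpa using (this.tendsto 0).mono_left nhdsWithin_le_nhds

theorem exists_coercive (hp : 1 < p) : ∃ c K : ℝ, 0 < c ∧
    ∀ v : EuclideanSpace ℝ (Fin d) → EuclideanSpace ℝ (Fin k), MemLp v (ENNReal.ofReal p) μ →
      c * ∫ x, ‖v x‖ ^ p ∂μ - K ≤ ∫ x, ⟪α x (v x), v x⟫_ℝ ∂μ := by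
  obtain ⟨c₃, c₄, hc₃, hc₄, h⟩ := hα.coercive
  have hp0 : 0 < p := by linarith
  have hi : Integrable c₄ μ := Integrable.mono_measure hc₄ hμ
  refine ⟨c₃, ∫ x, c₄ x ∂μ, hc₃, fun v hv => ?_⟩
  have hv' := hv.integrable_norm_rpow (by simpa using hp0) ENNReal.ofReal_ne_top
  rw [ENNReal.toReal_ofReal hp0.le] at hv'
  rw [← integral_const_mul, ← integral_sub (hv'.const_mul c₃) hi]
  refine integral_mono_ae ((hv'.const_mul c₃).sub hi) (hα.integrable_inner hμ hp hv hv) ?_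
  filter_upwards [ae_mono hμ h] with x hx
  exact hx _

end IsEnergyMap

end Energy

section Representation

variable {d k : ℕ} {Ω : Opens (EuclideanSpace ℝ (Fin d))} {p : ℝ}
  {μ : Measure (EuclideanSpace ℝ (Fin d))} {H : Type*} {τ : H → Fin k → 𝓓(Ω, ℝ) → ℝ}

theorem represents_energyRep {u : H} (hu : u ∈ energySpace p μ τ) :
    Represents p μ τ u (energyRep p μ τ u) := by
  have h : ∃ v, Represents p μ τ u v := hu
  rw [energyRep, dif_pos h]
  exact h.choose_spec

theorem memLp_testFunction [IsFiniteMeasureOnCompacts μ] (φ : 𝓓(Ω, ℝ)) (q : ENNReal) :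
    MemLp φ q μ :=
  φ.continuous.memLp_of_hasCompactSupport φ.hasCompactSupport

theorem memLp_apply {q : ENNReal} {v : EuclideanSpace ℝ (Fin d) → EuclideanSpace ℝ (Fin k)}
    (hv : MemLp v q μ) (j : Fin k) : MemLp (fun x => v x j) q μ :=
  (EuclideanSpace.proj j : EuclideanSpace ℝ (Fin k) →L[ℝ] ℝ).comp_memLp' hv

theorem integrable_apply_mul_testFunction [IsFiniteMeasure μ] (hp : 1 < p)
    {v : EuclideanSpace ℝ (Fin d) → EuclideanSpace ℝ (Fin k)}
    (hv : MemLp v (ENNReal.ofReal p) μ) (j : Fin k) (φ : 𝓓(Ω, ℝ)) :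
    Integrable (fun x => v x j * φ x) μ := by
  have := holderConjugate_ofReal hp
  have : (ENNReal.ofReal p).HolderTriple (ENNReal.ofReal (p / (p - 1))) 1 :=
    ENNReal.HolderTriple.symm
  exact (memLp_apply hv j).integrable_mul (memLp_testFunction φ (ENNReal.ofReal (p / (p - 1))))

/-- The representing function is unique, so that nothing depends on the choice in `energyRep`. -/
theorem ae_eq_of_represents [IsFiniteMeasure μ] (hμ : μ ≤ volume.restrict Ω) (hp : 1 < p) {u : H}
    {v w : EuclideanSpace ℝ (Fin d) → EuclideanSpace ℝ (Fin k)} (hv : Represents p μ τ u v)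
    (hw : Represents p μ τ u w) : v =ᵐ[μ] w := by
  have hΩ : ∀ᵐ x ∂μ, x ∈ (Ω : Set (EuclideanSpace ℝ (Fin d))) :=
    ae_mono hμ (ae_restrict_mem Ω.isOpen.measurableSet)
  have h : ∀ j, ∀ᵐ x ∂μ, x ∈ (Ω : Set (EuclideanSpace ℝ (Fin d))) →
      v x j - w x j = 0 := fun j => by
    have hint : Integrable (fun x => v x j - w x j) μ :=
      ((memLp_apply hv.1 j).sub (memLp_apply hw.1 j)).integrable
        (by rw [ENNReal.one_le_ofReal]; exact hp.le)
    refine Ω.isOpen.ae_eq_zero_of_integral_contDiff_smul_eq_zero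
      (hint.locallyIntegrable.locallyIntegrableOn _) fun g hg hgc hgs => ?_
    set φ : 𝓓(Ω, ℝ) := ⟨g, hg, hgc, hgs⟩ with hφ
    have h1 := (hv.2 j φ).symm.trans (hw.2 j φ)
    rw [← sub_eq_zero, ← integral_sub (integrable_apply_mul_testFunction hp hv.1 j φ)
      (integrable_apply_mul_testFunction hp hw.1 j φ)] at h1
    rw [← h1]
    refine integral_congr_ae (Eventually.of_forall fun x => ?_)
    change g x * (v x j - w x j) = v x j * g x - w x j * g x
    ring
  filter_upwards [ae_all_iff.mpr h, hΩ] with x hx hxΩ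
  ext j
  exact sub_eq_zero.mp (hx j hxΩ)

end Representation

/-! ### Maximal dissipativity of the Friedrich extension -/

section Solvability

variable {d k : ℕ} {Ω : Opens (EuclideanSpace ℝ (Fin d))} {p : ℝ}
  {α : EuclideanSpace ℝ (Fin d) → EuclideanSpace ℝ (Fin k) → EuclideanSpace ℝ (Fin k)}
  {μ : Measure (EuclideanSpace ℝ (Fin d))} [IsFiniteMeasure μ]
  {H : Type*} {τ : H → Fin k → 𝓓(Ω, ℝ) → ℝ}

theorem energyForm_eq_integral (hμ : μ ≤ volume.restrict Ω) (hp : 1 < p) {u u' : H}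
    {v v' : EuclideanSpace ℝ (Fin d) → EuclideanSpace ℝ (Fin k)} (hv : Represents p μ τ u v)
    (hv' : Represents p μ τ u' v') :
    energyForm p α μ τ u u' = ∫ x, ⟪α x (v x), v' x⟫_ℝ ∂μ := by
  have h1 := ae_eq_of_represents hμ hp (represents_energyRep ⟨v, hv⟩) hv
  have h2 := ae_eq_of_represents hμ hp (represents_energyRep ⟨v', hv'⟩) hv'
  refine integral_congr_ae ?_
  filter_upwards [h1, h2] with x hx hx'
  rw [hx, hx']

variable [NormedAddCommGroup H] [InnerProductSpace ℝ H]
  {L : Fin k → 𝓓(Ω, ℝ) → StrongDual ℝ H} (hτ : ∀ u j φ, τ u j φ = L j φ u)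

include hτ in
theorem represents_sub (hp : 1 < p) {u u' : H}
    {v v' : EuclideanSpace ℝ (Fin d) → EuclideanSpace ℝ (Fin k)} (hv : Represents p μ τ u v)
    (hv' : Represents p μ τ u' v') : Represents p μ τ (u - u') (v - v') := by
  refine ⟨hv.1.sub hv'.1, fun j φ => ?_⟩
  rw [hτ, map_sub, ← hτ, ← hτ, hv.2, hv'.2, ← integral_sub
    (integrable_apply_mul_testFunction hp hv.1 j φ)
    (integrable_apply_mul_testFunction hp hv'.1 j φ)]
  refine integral_congr_ae (Eventually.of_forall fun x => ?_)
  simp only [Pi.sub_apply, PiLp.sub_apply]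
  ring

/-- The graph of `u ↦ τ_p u` is closed in `H × L^p`. -/
theorem exists_isClosed_submodule_represents [Fact (1 ≤ ENNReal.ofReal p)] (hp : 1 < p) :
    ∃ X : Submodule ℝ (H × Lp (EuclideanSpace ℝ (Fin k)) (ENNReal.ofReal p) μ),
      IsClosed (X : Set (H × Lp (EuclideanSpace ℝ (Fin k)) (ENNReal.ofReal p) μ)) ∧
      ∀ q, q ∈ X ↔ ∀ j φ, L j φ q.1 = ∫ x, q.2 x j * φ x ∂μ := by
  have hpair : ∀ (j : Fin k) (φ : 𝓓(Ω, ℝ)),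
      ∃ ψ : StrongDual ℝ (Lp (EuclideanSpace ℝ (Fin k)) (ENNReal.ofReal p) μ),
        ∀ g, ψ g = ∫ x, g x j * φ x ∂μ := fun j φ => by
    have hm : MemLp (fun x => φ x • EuclideanSpace.single j (1 : ℝ))
        (ENNReal.ofReal (p / (p - 1))) μ :=
      (ContinuousLinearMap.toSpanSingleton ℝ (EuclideanSpace.single j (1 : ℝ))).comp_memLp'
        (memLp_testFunction φ _)
    obtain ⟨ψ, hψ⟩ := exists_dual_eq_integral hp hm
    refine ⟨ψ, fun g => (hψ g).trans (integral_congr_ae (Eventually.of_forall fun x => ?_))⟩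
    simp only [real_inner_smul_left, EuclideanSpace.inner_single_left, map_one, one_mul]
    rw [mul_comm]
  choose ψ hψ using hpair
  set Φ : Fin k → 𝓓(Ω, ℝ) →
      StrongDual ℝ (H × Lp (EuclideanSpace ℝ (Fin k)) (ENNReal.ofReal p) μ) := fun j φ =>
    (L j φ).comp (ContinuousLinearMap.fst ℝ H _) - (ψ j φ).comp (ContinuousLinearMap.snd ℝ H _)
    with hΦ
  have hmem : ∀ q : H × Lp (EuclideanSpace ℝ (Fin k)) (ENNReal.ofReal p) μ,
      q ∈ (⨅ j, ⨅ φ, LinearMap.ker (Φ j φ : _ →ₗ[ℝ] ℝ)) ↔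
      ∀ j φ, L j φ q.1 = ∫ x, q.2 x j * φ x ∂μ := fun q => by
    simp [Submodule.mem_iInf, hΦ, sub_eq_zero, hψ]
  refine ⟨_, ?_, hmem⟩
  simp only [Submodule.coe_iInf]
  exact isClosed_iInter fun j => isClosed_iInter fun φ => (Φ j φ).isClosed_ker

variable [CompleteSpace H] (hμ : μ ≤ volume.restrict Ω) (hp : 1 < p) (hα : IsEnergyMap Ω p α)
include hτ hμ hp hα

/-- The equation `u + h F u = y` in the dual of the energetic space is solvable, by the theorem of
Browder and Minty on the graph of `u ↦ τ_p u`. -/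
theorem exists_mem_energySpace_inner_add_eq_zero {h : ℝ} (hh : 0 < h) (y : H) :
    ∃ u ∈ energySpace p μ τ, ∀ v ∈ energySpace p μ τ,
      ⟪u - y, v⟫_ℝ + h * energyForm p α μ τ u v = 0 := by
  have hp0 : 0 < p := by linarith
  have := fact_one_le_ofReal hp
  obtain ⟨X, hXclosed, hX⟩ := exists_isClosed_submodule_represents (μ := μ) (L := L) hp
  have hXcomplete : CompleteSpace X := hXclosed.completeSpace_coe
  have hrep : ∀ q ∈ X, Represents p μ τ q.1 q.2 := fun q hq =>
    ⟨Lp.memLp _, fun j φ => (hτ _ j φ).trans ((hX q).mp hq j φ)⟩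
  choose Ψ hΨ using fun g : Lp (EuclideanSpace ℝ (Fin k)) (ENNReal.ofReal p) μ =>
    exists_dual_eq_integral hp (hα.memLp hμ hp (Lp.memLp g))
  set A : X → StrongDual ℝ X := fun q =>
    ((innerSL ℝ (q.1.1 - y)).comp (ContinuousLinearMap.fst ℝ H _) +
      h • (Ψ q.1.2).comp (ContinuousLinearMap.snd ℝ H _)).comp X.subtypeL with hA
  have hAapp : ∀ q r : X, A q r = ⟪q.1.1 - y, r.1.1⟫_ℝ +
      h * ∫ x, ⟪α x (q.1.2 x), r.1.2 x⟫_ℝ ∂μ := fun q r => by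
    simp [hA, hΨ, inner_sub_left]
  obtain ⟨c, K, hc, hcoer⟩ := hα.exists_coercive hμ hp
  obtain ⟨q, hq⟩ := exists_apply_eq_zero_of_monotone (fun q : X => sqAddRpow p q.1)
    (fun q => sqAddRpow_nonneg _) (by simp [sqAddRpow, Real.zero_rpow hp0.ne'])
    ((continuous_sqAddRpow hp).comp continuous_subtype_val)
    ⟨convex_univ, fun x _ y _ a b ha hb hab =>
      (convexOn_sqAddRpow hp).2 (mem_univ x.1) (mem_univ y.1) ha hb hab⟩
    (fun R ε hε => by
      obtain ⟨κ, hκ, hJ⟩ := sqAddRpow_uniformly_convex (E := EuclideanSpace ℝ (Fin k)) (μ := μ)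
        (H := H) hp R ε hε
      exact ⟨κ, hκ, fun x y hx hy hxy => hJ x y hx hy (by simpa using hxy)⟩)
    A
    (fun v w => by
      have hd : (fun x => ⟪α x (v.1.2 x), (v - w).1.2 x⟫_ℝ) =ᵐ[μ]
          fun x => ⟪α x (v.1.2 x), v.1.2 x - w.1.2 x⟫_ℝ := by
        filter_upwards [Lp.coeFn_sub v.1.2 w.1.2] with x hx
        change ⟪_, (v.1.2 - w.1.2 : Lp _ _ μ) x⟫_ℝ = _
        rw [hx, Pi.sub_apply]
      have hd' : (fun x => ⟪α x (w.1.2 x), (v - w).1.2 x⟫_ℝ) =ᵐ[μ]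
          fun x => ⟪α x (w.1.2 x), v.1.2 x - w.1.2 x⟫_ℝ := by
        filter_upwards [Lp.coeFn_sub v.1.2 w.1.2] with x hx
        change ⟪_, (v.1.2 - w.1.2 : Lp _ _ μ) x⟫_ℝ = _
        rw [hx, Pi.sub_apply]
      have h1 := hα.integral_monotone hμ hp (Lp.memLp v.1.2) (Lp.memLp w.1.2)
      rw [sub_apply, hAapp, hAapp, integral_congr_ae hd, integral_congr_ae hd']
      have h2 : ⟪v.1.1 - y, (v - w).1.1⟫_ℝ - ⟪w.1.1 - y, (v - w).1.1⟫_ℝ =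
          ‖v.1.1 - w.1.1‖ ^ 2 := by
        rw [← inner_sub_left, sub_sub_sub_cancel_right]
        exact real_inner_self_eq_norm_sq _
      have h3 := mul_nonneg hh.le h1
      have h4 : 0 ≤ ‖v.1.1 - w.1.1‖ ^ 2 := by positivity
      linarith)
    (fun u v => by
      have he : ∀ t : ℝ, A (u + t • v) v = ⟪u.1.1 + t • v.1.1 - y, v.1.1⟫_ℝ +
          h * ∫ x, ⟪α x (u.1.2 x + t • v.1.2 x), v.1.2 x⟫_ℝ ∂μ := fun t => by
        rw [hAapp]
        congr 2
        refine integral_congr_ae ?_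
        filter_upwards [Lp.coeFn_add u.1.2 (t • v.1.2), Lp.coeFn_smul t v.1.2] with x h1 h2
        change ⟪α x ((u.1.2 + t • v.1.2 : Lp _ _ μ) x), _⟫_ℝ = _
        rw [h1, Pi.add_apply, h2, Pi.smul_apply]
      simp_rw [he]
      rw [hAapp]
      refine Tendsto.add ?_
        ((hα.tendsto_integral hμ hp (Lp.memLp u.1.2) (Lp.memLp v.1.2)).const_mul h)
      have : Continuous fun t : ℝ => ⟪u.1.1 + t • v.1.1 - y, v.1.1⟫_ℝ := by fun_prop
      simpa using (this.tendsto 0).mono_left nhdsWithin_le_nhds)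
    (R := (‖y‖ ^ 2 / 2 + h * K + 1) / min (1 / 2) (h * c))
    (fun u hu => by
      have hm : 0 < min (1 / 2) (h * c) := by positivity
      rw [div_le_iff₀ hm, sqAddRpow, Lp_norm_rpow_eq_integral hp] at hu
      set I := ∫ x, ‖u.1.2 x‖ ^ p ∂μ with hI
      have hI0 : 0 ≤ I := integral_nonneg fun x => by positivity
      have h1 := mul_le_mul_of_nonneg_left (hcoer _ (Lp.memLp u.1.2)) hh.le
      -- the growth of `⟪u - y, u⟫ + h F u u` is that of `min (1/2) (h c) * sqAddRpow`
      have h2 : ‖u.1.1‖ ^ 2 * min (1 / 2) (h * c) ≤ ‖u.1.1‖ ^ 2 * (1 / 2) := by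
        gcongr; exact min_le_left _ _
      have h3 : I * min (1 / 2) (h * c) ≤ I * (h * c) := by
        gcongr; exact min_le_right _ _
      have h4 : ⟪u.1.1 - y, u.1.1⟫_ℝ ≥ ‖u.1.1‖ ^ 2 / 2 - ‖y‖ ^ 2 / 2 := by
        rw [inner_sub_left, real_inner_self_eq_norm_sq]
        nlinarith [real_inner_le_norm y u.1.1, sq_nonneg (‖y‖ - ‖u.1.1‖)]
      rw [hAapp]
      nlinarith)
  refine ⟨q.1.1, ⟨_, hrep _ q.2⟩, fun v hv => ?_⟩
  obtain ⟨w, hw⟩ := hv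
  have hwX : (v, hw.1.toLp) ∈ X := by
    rw [hX]
    intro j φ
    rw [← hτ, hw.2]
    refine integral_congr_ae ?_
    filter_upwards [hw.1.coeFn_toLp] with x hx
    rw [hx]
  have := hq ⟨_, hwX⟩
  rw [hAapp] at this
  rw [energyForm_eq_integral hμ hp (hrep _ q.2) (hrep _ hwX)]
  exact this

theorem isMaxDissipative_energy (hV : Dense (energySpace p μ τ)) :
    IsMaxDissipative (friedrichDomain (energySpace p μ τ) (energyForm p α μ τ))
      (friedrich (energySpace p μ τ) (energyForm p α μ τ)) := by
  refine isMaxDissipative_friedrich hV ?_ ?_ fun h hh y =>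
    exists_mem_energySpace_inner_add_eq_zero hτ hμ hp hα hh y
  · rintro u ⟨v, hv⟩ u' ⟨v', hv'⟩
    exact ⟨_, represents_sub hτ hp hv hv'⟩
  · rintro u ⟨v, hv⟩ u' ⟨v', hv'⟩
    have hd := represents_sub hτ hp hv hv'
    rw [energyForm_eq_integral hμ hp hv hd, energyForm_eq_integral hμ hp hv' hd]
    exact hα.integral_monotone hμ hp hv.1 hv'.1

end Solvability

/-! ### Domain decomposition and the sum splitting -/

namespace DomainDecomposition

variable {d s : ℕ} {Ω : Opens (EuclideanSpace ℝ (Fin d))} (P : DomainDecomposition Ω s)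

theorem dom_subset (ℓ : Fin s) : P.dom ℓ ⊆ (Ω : Set (EuclideanSpace ℝ (Fin d))) := by
  rw [← P.iUnion_dom]; exact subset_iUnion P.dom ℓ

theorem χ_nonneg (ℓ : Fin s) {x : EuclideanSpace ℝ (Fin d)} (hx : x ∈ Ω) : 0 ≤ P.χ ℓ x := by
  by_cases h : x ∈ P.dom ℓ
  · exact (P.pos ℓ x h).le
  · exact (P.zero ℓ x ⟨hx, h⟩).ge

theorem χ_le_one (ℓ : Fin s) {x : EuclideanSpace ℝ (Fin d)} (hx : x ∈ Ω) : P.χ ℓ x ≤ 1 := by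
  rw [← P.sum_eq_one x hx]
  exact Finset.single_le_sum (fun i _ => P.χ_nonneg i hx) (Finset.mem_univ ℓ)

theorem aemeasurable_ofReal_χ (ℓ : Fin s) :
    AEMeasurable (fun x => ENNReal.ofReal (P.χ ℓ x)) (volume.restrict Ω) :=
  ((P.smooth ℓ).continuousOn.aemeasurable Ω.isOpen.measurableSet).ennreal_ofReal

theorem ae_mem (Ω : Opens (EuclideanSpace ℝ (Fin d))) :
    ∀ᵐ x ∂(volume.restrict (Ω : Set (EuclideanSpace ℝ (Fin d)))), x ∈ Ω :=
  ae_restrict_mem Ω.isOpen.measurableSet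

/-- As `χ_ℓ` vanishes on `Ω \ Ω_ℓ`, the weighted measure may be taken on all of `Ω`. -/
theorem measure_eq (ℓ : Fin s) : P.measure ℓ =
    (volume.restrict (Ω : Set (EuclideanSpace ℝ (Fin d)))).withDensity
      fun x => ENNReal.ofReal (P.χ ℓ x) := by
  have h : (fun x => ENNReal.ofReal (P.χ ℓ x)) =ᵐ[volume.restrict Ω]
      (P.dom ℓ).indicator fun x => ENNReal.ofReal (P.χ ℓ x) := by
    filter_upwards [ae_mem Ω] with x hx
    by_cases hd : x ∈ P.dom ℓ
    · rw [indicator_of_mem hd]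
    · rw [indicator_of_notMem hd, P.zero ℓ x ⟨hx, hd⟩, ENNReal.ofReal_zero]
  rw [withDensity_congr_ae h, withDensity_indicator (P.isOpen_dom ℓ).measurableSet,
    Measure.restrict_restrict_of_subset (P.dom_subset ℓ)]
  rfl

theorem measure_le (ℓ : Fin s) : P.measure ℓ ≤ volume.restrict Ω := by
  rw [measure_eq]
  conv_rhs => rw [← withDensity_one (μ := volume.restrict (Ω : Set (EuclideanSpace ℝ (Fin d))))]
  refine withDensity_mono ?_
  filter_upwards [ae_mem Ω] with x hx
  exact ENNReal.ofReal_le_one.mpr (P.χ_le_one ℓ hx)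

theorem sum_measure : ∑ ℓ, P.measure ℓ = volume.restrict Ω := by
  refine Measure.ext fun t ht => ?_
  simp only [Measure.finsetSum_apply, measure_eq, withDensity_apply _ ht]
  rw [← lintegral_finsetSum' _ fun ℓ _ => (P.aemeasurable_ofReal_χ ℓ).restrict]
  have h : (fun x => ∑ ℓ, ENNReal.ofReal (P.χ ℓ x)) =ᵐ[(volume.restrict Ω).restrict t]
      fun _ => 1 := by
    filter_upwards [ae_restrict_of_ae (ae_mem Ω)] with x hx
    rw [← ENNReal.ofReal_sum_of_nonneg fun i _ => P.χ_nonneg i hx, P.sum_eq_one x hx,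
      ENNReal.ofReal_one]
  rw [lintegral_congr_ae h, lintegral_one, Measure.restrict_apply_univ]

theorem integral_measure {E : Type*} [NormedAddCommGroup E] [NormedSpace ℝ E] (ℓ : Fin s)
    (f : EuclideanSpace ℝ (Fin d) → E) :
    ∫ x, f x ∂(P.measure ℓ) = ∫ x in Ω, P.χ ℓ x • f x := by
  rw [measure_eq, integral_withDensity_eq_integral_toReal_smul₀ (P.aemeasurable_ofReal_χ ℓ)
    (Eventually.of_forall fun _ => ENNReal.ofReal_lt_top)]
  refine integral_congr_ae ?_
  filter_upwards [ae_mem Ω] with x hx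
  rw [ENNReal.toReal_ofReal (P.χ_nonneg ℓ hx)]

theorem integrable_measure {E : Type*} [NormedAddCommGroup E] [NormedSpace ℝ E] {ℓ : Fin s}
    {f : EuclideanSpace ℝ (Fin d) → E} (hf : Integrable f (P.measure ℓ)) :
    IntegrableOn (fun x => P.χ ℓ x • f x) Ω := by
  rw [measure_eq, integrable_withDensity_iff_integrable_smul₀' (P.aemeasurable_ofReal_χ ℓ)
    (Eventually.of_forall fun _ => ENNReal.ofReal_lt_top)] at hf
  refine hf.congr ?_
  filter_upwards [ae_mem Ω] with x hx
  rw [ENNReal.toReal_ofReal (P.χ_nonneg ℓ hx)]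

/-- Since `0 ≤ χ ≤ 1`, one has `|χ v|^p ≤ χ |v|^p`. -/
theorem memLp_χ_smul {E : Type*} [NormedAddCommGroup E] [NormedSpace ℝ E] {p : ℝ} (hp : 1 < p)
    {ℓ : Fin s} [IsFiniteMeasure (P.measure ℓ)] {v : EuclideanSpace ℝ (Fin d) → E}
    (hv : MemLp v (ENNReal.ofReal p) (P.measure ℓ)) :
    MemLp (fun x => P.χ ℓ x • v x) (ENNReal.ofReal p) (volume.restrict Ω) := by
  have hp0 : 0 < p := by linarith
  have h0 : ENNReal.ofReal p ≠ 0 := by simpa using hp0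
  have hmeas : AEStronglyMeasurable (fun x => P.χ ℓ x • v x) (volume.restrict Ω) :=
    (P.integrable_measure (hv.integrable (ENNReal.one_le_ofReal.mpr hp.le))).1
  have hint := P.integrable_measure (hv.integrable_norm_rpow h0 ENNReal.ofReal_ne_top)
  rw [ENNReal.toReal_ofReal hp0.le] at hint
  rw [← integrable_norm_rpow_iff hmeas h0 ENNReal.ofReal_ne_top, ENNReal.toReal_ofReal hp0.le]
  refine hint.mono' (hmeas.norm.aemeasurable.pow_const p).aestronglyMeasurable ?_
  filter_upwards [ae_mem Ω] with x hx
  have h1 := P.χ_nonneg ℓ hx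
  rw [Real.norm_of_nonneg (by positivity), norm_smul, Real.norm_of_nonneg h1,
    Real.mul_rpow h1 (norm_nonneg _), smul_eq_mul]
  gcongr
  exact Real.rpow_le_self_of_le_one h1 (P.χ_le_one ℓ hx) hp.le

theorem sum_mulTest (φ : 𝓓(Ω, ℝ)) : ∑ ℓ, mulTest (P.χ ℓ) (P.smooth ℓ) φ = φ := by
  ext x
  have h : (∑ ℓ, mulTest (P.χ ℓ) (P.smooth ℓ) φ) x = ∑ ℓ, P.χ ℓ x * φ x := by
    simp only [sum_apply]; rfl
  rw [h, ← Finset.sum_mul]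
  by_cases hx : x ∈ Ω
  · rw [P.sum_eq_one x hx, one_mul]
  · rw [image_eq_zero_of_notMem_tsupport fun h => hx (φ.tsupport_subset h), mul_zero]

end DomainDecomposition

section Gluing

variable {d k s : ℕ} {Ω : Opens (EuclideanSpace ℝ (Fin d))} {p : ℝ}
  {α : EuclideanSpace ℝ (Fin d) → EuclideanSpace ℝ (Fin k) → EuclideanSpace ℝ (Fin k)}
  {H : Type*} [NormedAddCommGroup H] [InnerProductSpace ℝ H]
  {δ : H →ₗ[ℝ] (Fin k → 𝓓'(Ω, ℝ))} (P : DomainDecomposition Ω s)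

theorem represents_part_of_full (ℓ : Fin s) {u : H}
    {v : EuclideanSpace ℝ (Fin d) → EuclideanSpace ℝ (Fin k)}
    (hv : Represents p (volume.restrict Ω) (fullFunctional δ) u v) :
    Represents p (P.measure ℓ) (partFunctional δ P ℓ) u v := by
  refine ⟨hv.1.mono_measure (P.measure_le ℓ), fun j φ => ?_⟩
  rw [P.integral_measure]
  refine (hv.2 j (mulTest (P.χ ℓ) (P.smooth ℓ) φ)).trans
    (integral_congr_ae (Eventually.of_forall fun x => ?_))
  change v x j * (P.χ ℓ x * φ x) = P.χ ℓ x * (v x j * φ x)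
  ring

theorem fullSpace_subset_partSpace (ℓ : Fin s) : fullSpace p δ ⊆ partSpace p δ P ℓ :=
  fun _ ⟨v, hv⟩ => ⟨v, represents_part_of_full P ℓ hv⟩

variable [IsFiniteMeasure (volume.restrict (Ω : Set (EuclideanSpace ℝ (Fin d))))]

/-- The representing functions `v_ℓ` of the parts are glued to `∑ ℓ, χ_ℓ v_ℓ`. -/
theorem mem_fullSpace_of_forall_mem_partSpace (hp : 1 < p) {u : H}
    (hu : ∀ ℓ, u ∈ partSpace p δ P ℓ) : u ∈ fullSpace p δ := by
  choose v hv using hu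
  have hfin : ∀ ℓ, IsFiniteMeasure (P.measure ℓ) := fun ℓ =>
    isFiniteMeasure_of_le _ (P.measure_le ℓ)
  refine ⟨fun x => ∑ ℓ, P.χ ℓ x • v ℓ x,
    memLp_finsetSum _ fun ℓ _ => P.memLp_χ_smul hp (hv ℓ).1, fun j φ => ?_⟩
  have h1 : ∀ x, (∑ ℓ, P.χ ℓ x • v ℓ x) j * φ x = ∑ ℓ, P.χ ℓ x • (v ℓ x j * φ x) := fun x => by
    simp [Finset.sum_mul, mul_assoc]
  simp only [h1]
  rw [integral_finsetSum _ fun ℓ _ =>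
    P.integrable_measure (integrable_apply_mul_testFunction hp (hv ℓ).1 j φ)]
  simp only [← P.integral_measure, ← (hv _).2]
  change δ u j φ = ∑ ℓ, δ u j (mulTest (P.χ ℓ) (P.smooth ℓ) φ)
  rw [← map_sum, P.sum_mulTest]

theorem fullForm_eq_sum_partForm (hp : 1 < p) (hα : IsEnergyMap Ω p α) {u w : H}
    (hu : u ∈ fullSpace p δ) (hw : w ∈ fullSpace p δ) :
    fullForm p α δ u w = ∑ ℓ, partForm p α δ P ℓ u w := by
  obtain ⟨v, hv⟩ := hu
  obtain ⟨z, hz⟩ := hw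
  have hfin : ∀ ℓ, IsFiniteMeasure (P.measure ℓ) := fun ℓ =>
    isFiniteMeasure_of_le _ (P.measure_le ℓ)
  have h1 : ∀ ℓ, partForm p α δ P ℓ u w = ∫ x, ⟪α x (v x), z x⟫_ℝ ∂(P.measure ℓ) := fun ℓ =>
    energyForm_eq_integral (P.measure_le ℓ) hp (represents_part_of_full P ℓ hv)
      (represents_part_of_full P ℓ hz)
  rw [fullForm, energyForm_eq_integral le_rfl hp hv hz, Finset.sum_congr rfl fun ℓ _ => h1 ℓ,
    ← integral_finsetSum_measure fun ℓ _ => hα.integrable_inner (P.measure_le ℓ) hp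
      (hv.1.mono_measure (P.measure_le ℓ)) (hz.1.mono_measure (P.measure_le ℓ)), P.sum_measure]

/-- On the intersection of the domains of the `f_ℓ`, the field `f` is the sum of the `f_ℓ`. -/
theorem fullField_eq_sum_partField [CompleteSpace H] (hp : 1 < p) (hα : IsEnergyMap Ω p α)
    (hV : Dense (fullSpace p δ)) {u : H} (hu : ∀ ℓ, u ∈ partDomain p α δ P ℓ) :
    u ∈ fullDomain p α δ ∧ fullField p α δ u = ∑ ℓ, partField p α δ P ℓ u := by
  have huV : u ∈ fullSpace p δ := mem_fullSpace_of_forall_mem_partSpace P hp fun ℓ => (hu ℓ).1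
  have h : ∀ w ∈ fullSpace p δ, ⟪-∑ ℓ, partField p α δ P ℓ u, w⟫_ℝ = fullForm p α δ u w :=
    fun w hw => by
      rw [fullForm_eq_sum_partForm P hp hα huV hw, inner_neg_left, sum_inner,
        ← Finset.sum_neg_distrib]
      refine Finset.sum_congr rfl fun ℓ _ => ?_
      rw [partField, inner_friedrich (hu ℓ) (fullSpace_subset_partSpace P ℓ hw), neg_neg]
  refine ⟨mem_friedrichDomain_of_inner huV h, ?_⟩
  rw [fullField, friedrich_eq_neg hV huV h, neg_neg]

end Gluing

section Splitting

variable {H : Type*} [NormedAddCommGroup H] [InnerProductSpace ℝ H] [CompleteSpace H]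

/-- The sum splitting of `g = ∑ ℓ, g_ℓ` is consistent, since its generators are the sums of the
Yosida approximations `(R_ℓ(s h) - I) / (s h)` of the `g_ℓ`. -/
theorem isConsistent_average_nlResolvent {s : ℕ} (hs : 0 < s) {D : Set H} {g : H → H}
    (hg : IsMaxDissipative D g) {D' : Fin s → Set H} {g' : Fin s → H → H}
    (hg' : ∀ ℓ, IsMaxDissipative (D' ℓ) (g' ℓ))
    (hsum : ∀ u, (∀ ℓ, u ∈ D' ℓ) → u ∈ D ∧ g u = ∑ ℓ, g' ℓ u) {W : Set H} (hW : Dense W)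
    (hrange : ∀ l : ℝ, 0 < l → ∀ v ∈ W, ∃ u, (∀ ℓ, u ∈ D' ℓ) ∧ u - l • g u = v) :
    IsConsistent D g fun h u => (1 / (s : ℝ)) • ∑ ℓ, nlResolvent (D' ℓ) (g' ℓ) (h * s) u where
  nonexpansive h hh x y := by
    have hs' : (0 : ℝ) < s := by exact_mod_cast hs
    rw [← smul_sub, ← Finset.sum_sub_distrib, norm_smul, Real.norm_of_nonneg (by positivity)]
    calc 1 / (s : ℝ) * ‖∑ ℓ, (nlResolvent (D' ℓ) (g' ℓ) (h * s) x -
          nlResolvent (D' ℓ) (g' ℓ) (h * s) y)‖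
        ≤ 1 / (s : ℝ) * ∑ _ℓ : Fin s, ‖x - y‖ := by
          gcongr
          exact norm_sum_le_of_le _ fun ℓ _ =>
            (hg' ℓ).norm_nlResolvent_sub_le (by positivity) x y
      _ = ‖x - y‖ := by simp [hs'.ne']
  tendsto := by
    have hs' : (0 : ℝ) < s := by exact_mod_cast hs
    refine ⟨W, hW, fun v hv l hl => ?_⟩
    obtain ⟨u, hu, huv⟩ := hrange l hl v hv
    obtain ⟨huD, hgu⟩ := hsum u hu
    rw [hg.nlResolvent_eq hl huD huv, hgu]
    have hmul : Tendsto (fun h : ℝ => h * s) (𝓝[>] 0) (𝓝[>] 0) := by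
      refine tendsto_nhdsWithin_of_tendsto_nhds_of_eventually_within _ ?_ ?_
      · have : Continuous fun h : ℝ => h * s := by fun_prop
        simpa using (this.tendsto 0).mono_left nhdsWithin_le_nhds
      · filter_upwards [self_mem_nhdsWithin] with h (hh : 0 < h)
        exact mul_pos hh hs'
    refine (tendsto_finsetSum Finset.univ fun ℓ _ =>
      ((hg' ℓ).tendsto_smul_nlResolvent_sub (hu ℓ)).comp hmul).congr fun h => ?_
    simp only [Function.comp_apply]
    rw [← Finset.smul_sum, Finset.sum_sub_distrib, Finset.sum_const, Finset.card_univ,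
      Fintype.card_fin, ← Nat.cast_smul_eq_nsmul ℝ s u, mul_inv, mul_smul, smul_sub (s : ℝ)⁻¹,
      inv_smul_smul₀ hs'.ne', one_div]

end Splitting

end DomainSplitting

/-! ### Convergence of the sum splitting -/

theorem mainTheorem1 {d k s : ℕ} (hd : 1 ≤ d) (hk : 1 ≤ k)
    (Ω : Opens (EuclideanSpace ℝ (Fin d)))
    (hΩconn : IsConnected (Ω : Set (EuclideanSpace ℝ (Fin d))))
    (hΩbdd : Bornology.IsBounded (Ω : Set (EuclideanSpace ℝ (Fin d))))
    (P : DomainDecomposition Ω s)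
    (p : ℝ) (hp : 1 < p)
    {H : Type*} [NormedAddCommGroup H] [InnerProductSpace ℝ H] [CompleteSpace H]
    (δ : H →ₗ[ℝ] (Fin k → 𝓓'(Ω, ℝ)))
    -- sequential continuity of `δ`
    (hδ : ∀ (u : ℕ → H) (u₀ : H), Tendsto u atTop (𝓝 u₀) →
      ∀ (j : Fin k) (φ : 𝓓(Ω, ℝ)), Tendsto (fun n => δ (u n) j φ) atTop (𝓝 (δ u₀ j φ)))
    -- density of `V`
    (hV : Dense (fullSpace p δ))
    -- Carathéodory, growth, monotonicity and coercivity conditions on `α`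
    (α : EuclideanSpace ℝ (Fin d) → EuclideanSpace ℝ (Fin k) → EuclideanSpace ℝ (Fin k))
    (hα : IsEnergyMap Ω p α)
    -- range condition on the restriction of `I - h f` to the intersection of the `D(f_ℓ)`
    (hrange : ∀ h : ℝ, 0 < h → ∀ v ∈ fullSpace p δ,
      ∃ u ∈ ⋂ ℓ, partDomain p α δ P ℓ, u - h • fullField p α δ u = v)
    -- density of `D(f)`
    (hdense : Dense (fullDomain p α δ)) :
    -- the resolvents of the `f_ℓ` and of `f` are well defined on `H`
    (∀ ℓ, ∀ h : ℝ, 0 < h → ∀ y : H,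
      ∃! u, u ∈ partDomain p α δ P ℓ ∧ u - h • partField p α δ P ℓ u = y) ∧
    (∀ h : ℝ, 0 < h → ∀ y : H,
      ∃! u, u ∈ fullDomain p α δ ∧ u - h • fullField p α δ u = y) ∧
    -- the limit defining `e^{tf} η` exists
    (∀ t : ℝ, 0 < t → ∀ η : H,
      Tendsto (fun n : ℕ => (nlResolvent (fullDomain p α δ) (fullField p α δ) (t / n))^[n] η)
        atTop (𝓝 (nlSemigroup (fullDomain p α δ) (fullField p α δ) t η))) ∧
    -- convergence of the sum splitting, uniformly on bounded time intervals
    (∀ (η : H) (T : ℝ),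
      TendstoUniformlyOn (fun (n : ℕ) (t : ℝ) => (sumSplitting p α δ P (t / n))^[n] η)
        (fun t => nlSemigroup (fullDomain p α δ) (fullField p α δ) t η) atTop (Ioo 0 T)) := by
  have hfinΩ : IsFiniteMeasure (volume.restrict (Ω : Set (EuclideanSpace ℝ (Fin d)))) :=
    isFiniteMeasure_restrict.mpr hΩbdd.measure_lt_top.ne
  have hfin : ∀ ℓ, IsFiniteMeasure (P.measure ℓ) := fun ℓ =>
    isFiniteMeasure_of_le _ (P.measure_le ℓ)
  have hs : 0 < s := by
    obtain ⟨x, hx⟩ := hΩconn.nonempty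
    rcases Nat.eq_zero_or_pos s with rfl | h
    · simpa using P.sum_eq_one x hx
    · exact h
  have hadd : ∀ u v j (φ : 𝓓(Ω, ℝ)), δ (u + v) j φ = δ u j φ + δ v j φ := fun u v j φ => by
    rw [map_add]; rfl
  have hsmul : ∀ (c : ℝ) u j (φ : 𝓓(Ω, ℝ)), δ (c • u) j φ = c • δ u j φ := fun c u j φ => by
    rw [map_smul]; rfl
  -- a sequentially continuous functional on the metric space `H` is continuous
  obtain ⟨L, hL⟩ : ∃ L : Fin k → 𝓓(Ω, ℝ) → StrongDual ℝ H, ∀ u j φ, δ u j φ = L j φ u :=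
    ⟨fun j φ => ⟨IsLinearMap.mk' (fun u => δ u j φ)
      ⟨fun u v => hadd u v j φ, fun c u => hsmul c u j φ⟩,
      SeqContinuous.continuous fun u u₀ hu => hδ u u₀ hu j φ⟩, fun _ _ _ => rfl⟩
  have hfull : IsMaxDissipative (fullDomain p α δ) (fullField p α δ) :=
    isMaxDissipative_energy (L := L) (fun u j φ => hL u j φ) le_rfl hp hα hV
  have hpart : ∀ ℓ, IsMaxDissipative (partDomain p α δ P ℓ) (partField p α δ P ℓ) := fun ℓ =>
    isMaxDissipative_energy (L := fun j φ => L j (mulTest (P.χ ℓ) (P.smooth ℓ) φ))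
      (fun u j φ => hL u j _) (P.measure_le ℓ) hp hα (hV.mono (fullSpace_subset_partSpace P ℓ))
  have hcons : IsConsistent (fullDomain p α δ) (fullField p α δ) (sumSplitting p α δ P) :=
    isConsistent_average_nlResolvent hs hfull hpart
      (fun u hu => fullField_eq_sum_partField P hp hα hV hu) hV fun l hl v hv => by
        obtain ⟨u, hu, huv⟩ := hrange l hl v hv
        exact ⟨u, mem_iInter.mp hu, huv⟩
  exact ⟨fun ℓ h hh y => (hpart ℓ).existsUnique hh y, fun h hh y => hfull.existsUnique hh y,
    fun t ht η => hfull.tendsto_nlSemigroup hdense ht η,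
    fun η T => hfull.tendstoUniformlyOn_iterate hdense hcons η T⟩
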